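/- Let $k$ be a field and let $n,m\ge 2$ be integers. A persistence module over a poset $P$ is a functor from $P$ to finite-dimensional $k$-vector spaces. An interval of $P$ is a nonempty, convex and connected subset $I$; its interval module $kI$ is $k$ at the points of $I$ and $0$ elsewhere, with identity maps inside $I$ and zero maps otherwise. If $P$ is finite, a barcode of a persistence module $F$ over $P$ is a multiset of intervals, with multiplicity function $\mu_F$, such that $F\cong\bigoplus_I (kI)^{\mu_F(I)}$. Let $B=\{0,\dots,n+m-1\}$ be the bipath poset with the two maximal chains $0<1<\dots<n$ and $0<n+m-1<n+m-2<\dots<n$. In terms of the order $\le_B$ of $B$, consider the following intervals of $B$: - the full interval $B$; - $[i,j]_{\triangleleft}=\{z: 0\le_B z\le_B i\}\cup\{z: 0\le_B z\le_B j\}$ for $i\in\{0,\dots,n-1\}$ and $j\in\{0\}\cup\{n+1,\dots,n+m-1\}$; - $[i,j]_{\triangleright}=\{z: i\le_B z\le_B n\}\cup\{z: j\le_B z\le_B n\}$ for $i\in\{1,\dots,n\}$ and $j\in\{n,\dots,n+m-1\}$; - $[i,j]_{\top}=\{z: i\le_B z\le_B j\}$ for integers $1\le i\le j\le n-1$; -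 $[i,j]_{\bot}=\{z: j\le_B z\le_B i\}$ for integers $n+1\le i\le j\le n+m-1$. Let $\mathbb{ZZ}=\{(a,b)\in\mathbb Z^{\mathrm{op}}\times\mathbb Z : a=b\text{ or }a=b+1\}$ be the zigzag poset, and for integers $a,b$ put $[a,b]_{\mathbb{ZZ}}=\{(c,d): c\le b,\ d\ge a\}$, $[a,b)_{\mathbb{ZZ}}=\{(c,d): a\le d<b\}$, $(a,b]_{\mathbb{ZZ}}=\{(c,d): a<c\le b\}$, $(a,b)_{\mathbb{ZZ}}=\{(c,d): c>a,\ d<b\}$ (subsets of $\mathbb{ZZ}$). With $N=n+m-1$, let $\zeta:\mathbb{ZZ}\to B$ be the order-preserving map given, for all $k\in\mathbb Z$, by $\zeta(kN+1,kN)=0$; $\zeta(kN+i,kN+i)=\zeta(kN+i+1,kN+i)=i$ for $1\le i\le n-1$; $\zeta(kN+n,kN+n)=n$; and $\zeta(kN-i+1,kN-i)=\zeta(kN-i+1,kN-i+1)=n+m-i$ for $1\le i\le m-1$. Let $\overline{\mathbb{ZZ}}=(-m+1,n+m)_{\mathbb{ZZ}}$ with the induced order, and for a persistence module $M$ over $B$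 let $\overline R(M)=M\circ\zeta|_{\overline{\mathbb{ZZ}}}$; intervals of $\overline{\mathbb{ZZ}}$ are denoted as above. **Theorem.** The poset $\overline{\mathbb{ZZ}}$ has $2n+4m-3$ points, and every interval of $B$ is one of those listed above. Every persistence module $M$ over $B$ has a unique barcode (its arc code, with multiplicities $\mu_M$), and $\overline R(M)$ has a unique barcode (with multiplicities $\mu_{\overline R(M)}$). For all $i,j$ in the ranges above, - $\mu_M(B)=\mu_{\overline R(M)}(\overline{\mathbb{ZZ}})$; - $\mu_M([i,0]_{\triangleleft})=\mu_{\overline R(M)}((0,i+1)_{\mathbb{ZZ}})$; - $\mu_M([i,j]_{\triangleleft})=\mu_{\overline R(M)}((-n-m+j,i+1)_{\mathbb{ZZ}})$ if $j\ne0$; - $\mu_M([i,j]_{\triangleright})=\mu_{\overline R(M)}([i,j]_{\mathbb{ZZ}})$; - $\mu_M([i,j]_{\top})=\mu_{\overline R(M)}([i,j+1)_{\mathbb{ZZ}})$; - $\mu_M([i,j]_{\bot})=\mu_{\overline R(M)}((i-1,j]_{\mathbb{ZZ}})$. -/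

import Mathlib

open CategoryTheory CategoryTheory.Limits

universe u v

noncomputable section

/-! ### Persistence modules, intervals and barcodes over a poset -/

/-- A persistence module over `P`: a functor from `P` to finite-dimensional `k`-vector spaces. -/
abbrev PersistenceModule (k : Type u) [Field k] (P : Type v) [Preorder P] : Type _ :=
  P ⥤ FGModuleCat.{u} k

/-- An interval of a poset: a nonempty, convex and connected subset. Connected means that any two
elements are joined by a finite sequence of consecutively comparable elements of the subset. -/
@[ext]
structure PosetInterval (P : Type v) [Preorder P] where
  carrier : Set P
  nonempty : carrier.Nonempty
  convex : ∀ p ∈ carrier, ∀ q ∈ carrier, ∀ z, p ≤ z → z ≤ q → z ∈ carrier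
  connected : ∀ p q : carrier, Relation.ReflTransGen (fun x y : carrier => x ≤ y ∨ y ≤ x) p q

instance (P : Type v) [Preorder P] [Finite P] : Finite (PosetInterval P) :=
  Finite.of_injective PosetInterval.carrier fun _ _ h => PosetInterval.ext h

open Classical in
/-- The space of the interval module at `p`: all of `k` if `p ∈ I` and zero otherwise. -/
def intervalStalk (k : Type u) [Field k] {P : Type v} [Preorder P] (I : PosetInterval P) (p : P) :
    Submodule k k :=
  if p ∈ I.carrier then ⊤ else ⊥

open Classical in
/-- The internal map of the interval module: the identity if `p, q ∈ I` and zero otherwise. -/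
def intervalMap (k : Type u) [Field k] {P : Type v} [Preorder P] (I : PosetInterval P) (p q : P) :
    intervalStalk k I p →ₗ[k] intervalStalk k I q :=
  if h : p ∈ I.carrier ∧ q ∈ I.carrier then
    Submodule.inclusion (by simp [intervalStalk, h.1, h.2])
  else 0

lemma intervalStalk_eq_zero (k : Type u) [Field k] {P : Type v} [Preorder P] (I : PosetInterval P)
    (p : P) (hp : p ∉ I.carrier) (x : intervalStalk k I p) : x = 0 := by
  obtain ⟨x, hx⟩ := x
  simp only [intervalStalk, if_neg hp, Submodule.mem_bot] at hx
  exact Subtype.ext hx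

lemma intervalMap_self (k : Type u) [Field k] {P : Type v} [Preorder P] (I : PosetInterval P)
    (p : P) : intervalMap k I p p = LinearMap.id := by
  by_cases hp : p ∈ I.carrier
  · ext x
    simp [intervalMap, hp]
  · exact LinearMap.ext fun x => by
      rw [intervalStalk_eq_zero k I p hp x, map_zero, map_zero]

lemma intervalMap_comp (k : Type u) [Field k] {P : Type v} [Preorder P] (I : PosetInterval P)
    {p q r : P} (hpq : p ≤ q) (hqr : q ≤ r) :
    intervalMap k I q r ∘ₗ intervalMap k I p q = intervalMap k I p r := by
  by_cases hp : p ∈ I.carrier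
  · by_cases hr : r ∈ I.carrier
    · have hq : q ∈ I.carrier := I.convex p hp r hr q hpq hqr
      ext x
      simp [intervalMap, hp, hq, hr]
    · ext x
      simp [intervalMap, hr]
  · exact LinearMap.ext fun x => by
      rw [intervalStalk_eq_zero k I p hp x, map_zero, map_zero]

/-- The interval module `k I`. -/
def intervalModule (k : Type u) [Field k] {P : Type v} [Preorder P] (I : PosetInterval P) :
    PersistenceModule k P where
  obj p := FGModuleCat.of k (intervalStalk k I p)
  map {p q} _ := FGModuleCat.ofHom (intervalMap k I p q)
  map_id p := by
    rw [intervalMap_self]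
    rfl
  map_comp {p q r} f g := by
    rw [← intervalMap_comp k I (leOfHom f) (leOfHom g)]
    rfl

instance (k : Type u) [Field k] (P : Type v) [Preorder P] :
    HasFiniteBiproducts (PersistenceModule k P) :=
  HasFiniteBiproducts.of_hasFiniteProducts

/-- `μ` is (the multiplicity function of) a barcode of `M`: the module `M` is isomorphic to the
direct sum of the interval modules `k I`, each one taken `μ I` times. -/
def IsBarcode {k : Type u} [Field k] {P : Type v} [Preorder P] [Finite P]
    (M : PersistenceModule k P) (μ : PosetInterval P → ℕ) : Prop :=
  Nonempty (M ≅ ⨁ fun x : (Σ I : PosetInterval P, Fin (μ I)) => intervalModule k x.1)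

/-! ### The bipath poset -/

/-- The underlying set `{0, …, n + m - 1}` of the bipath poset. -/
@[ext]
structure Bipath (n m : ℕ) where
  val : ℕ
  isLt : val < n + m

namespace Bipath

instance (n m : ℕ) : Finite (Bipath n m) :=
  Finite.of_injective (fun x => (⟨x.val, x.isLt⟩ : Fin (n + m))) fun x y h => by
    ext
    simpa using h

/-- The order with the two maximal chains `0 < 1 < ⋯ < n` and
`0 < n + m - 1 < n + m - 2 < ⋯ < n`. -/
instance (n m : ℕ) [hn : Fact (1 < n)] : PartialOrder (Bipath n m) where
  le x y := x.val = 0 ∨ (x.val ≤ y.val ∧ y.val ≤ n) ∨ (n ≤ y.val ∧ y.val ≤ x.val)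
  le_refl x := by omega
  le_trans x y z hxy hyz := by
    have := hn.out
    omega
  le_antisymm x y hxy hyx := by
    have := hn.out
    ext
    omega

variable {n m : ℕ} [hn : Fact (1 < n)]

lemma le_def (x y : Bipath n m) :
    x ≤ y ↔ x.val = 0 ∨ (x.val ≤ y.val ∧ y.val ≤ n) ∨ (n ≤ y.val ∧ y.val ≤ x.val) :=
  Iff.rfl

/-- The least element `0`. -/
def zero (n m : ℕ) [hn : Fact (1 < n)] : Bipath n m := ⟨0, by have := hn.out; omega⟩

/-- The greatest element `n`. -/
def last (n m : ℕ) [hm : Fact (1 < m)] : Bipath n m := ⟨n, by have := hm.out; omega⟩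

lemma zero_le (x : Bipath n m) : zero n m ≤ x := Or.inl rfl

lemma le_last [hm : Fact (1 < m)] (x : Bipath n m) : x ≤ last n m := by
  rw [le_def]
  simp only [last]
  omega

end Bipath

/-- A convex subset in which all elements are comparable with one fixed element is an interval. -/
def PosetInterval.ofHub {P : Type v} [Preorder P] (S : Set P) (a : P) (ha : a ∈ S)
    (hS : ∀ p ∈ S, ∀ q ∈ S, ∀ z, p ≤ z → z ≤ q → z ∈ S) (h : ∀ p ∈ S, p ≤ a ∨ a ≤ p) :
    PosetInterval P where
  carrier := S
  nonempty := ⟨a, ha⟩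
  convex := hS
  connected p q :=
    (Relation.ReflTransGen.single (b := (⟨a, ha⟩ : S)) (h p p.2)).trans
      (Relation.ReflTransGen.single (a := (⟨a, ha⟩ : S)) (h q q.2).symm)

section BipathIntervals

variable {n m : ℕ} [hn : Fact (1 < n)] [hm : Fact (1 < m)]

/-- The full interval. -/
def fullInterval (n m : ℕ) [hn : Fact (1 < n)] : PosetInterval (Bipath n m) :=
  .ofHub Set.univ (Bipath.zero n m) trivial (fun _ _ _ _ _ _ _ => trivial)
    fun p _ => Or.inr (Bipath.zero_le p)

/-- The left interval `[i, j]_◁`, for `i ∈ {0, …, n - 1}` and `j ∈ {0, n + m - 1, …, n + 1}`. -/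
def leftInterval (i j : Bipath n m) (_hi : i.val < n) (_hj : j.val = 0 ∨ n < j.val) :
    PosetInterval (Bipath n m) :=
  .ofHub (Set.Icc (Bipath.zero n m) i ∪ Set.Icc (Bipath.zero n m) j) (Bipath.zero n m)
    (Or.inl ⟨le_rfl, Bipath.zero_le i⟩)
    (by
      rintro p - q (⟨-, hq⟩ | ⟨-, hq⟩) z - hz
      · exact Or.inl ⟨Bipath.zero_le z, hz.trans hq⟩
      · exact Or.inr ⟨Bipath.zero_le z, hz.trans hq⟩)
    fun p _ => Or.inr (Bipath.zero_le p)

/-- The right interval `[i, j]_▷`, for `i ∈ {1, …, n}` and `j ∈ {n + m - 1, …, n}`. -/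
def rightInterval (i j : Bipath n m) (_hi : 0 < i.val ∧ i.val ≤ n) (_hj : n ≤ j.val) :
    PosetInterval (Bipath n m) :=
  .ofHub (Set.Icc i (Bipath.last n m) ∪ Set.Icc j (Bipath.last n m)) (Bipath.last n m)
    (Or.inl ⟨Bipath.le_last i, le_rfl⟩)
    (by
      rintro p (⟨hp, -⟩ | ⟨hp, -⟩) q - z hz -
      · exact Or.inl ⟨hp.trans hz, Bipath.le_last z⟩
      · exact Or.inr ⟨hp.trans hz, Bipath.le_last z⟩)
    fun p _ => Or.inl (Bipath.le_last p)

/-- The top interval `[i, j]_⊤ = {z | i ≤ z ≤ j}`, for `1 ≤ i ≤ j ≤ n - 1`. -/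
def topInterval (i j : Bipath n m) (_hi : 0 < i.val) (hij : i.val ≤ j.val) (hj : j.val < n) :
    PosetInterval (Bipath n m) :=
  .ofHub (Set.Icc i j) i ⟨le_rfl, by rw [Bipath.le_def]; omega⟩
    (fun _ hp _ hq _ hpz hzq => ⟨hp.1.trans hpz, hzq.trans hq.2⟩) fun _ hp => Or.inr hp.1

/-- The bottom interval `[i, j]_⊥ = {z | j ≤ z ≤ i}`, for `n + 1 ≤ i ≤ j ≤ n + m - 1` as numbers
(so that `j ≤ i` in the bipath order). -/
def bottomInterval (i j : Bipath n m) (hi : n < i.val) (hij : i.val ≤ j.val) :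
    PosetInterval (Bipath n m) :=
  .ofHub (Set.Icc j i) j ⟨le_rfl, by rw [Bipath.le_def]; omega⟩
    (fun _ hp _ hq _ hpz hzq => ⟨hp.1.trans hpz, hzq.trans hq.2⟩) fun _ hp => Or.inr hp.1

end BipathIntervals

/-! ### The zigzag poset and its intervals -/

/-- The zigzag poset, a subposet of `ℤᵒᵖ × ℤ`. -/
abbrev ZigzagPoset : Type :=
  {p : ℤᵒᵈ × ℤ // OrderDual.ofDual p.1 = p.2 ∨ OrderDual.ofDual p.1 = p.2 + 1}

namespace ZigzagPoset

/-- The first coordinate, as an integer. -/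
def fst (p : ZigzagPoset) : ℤ := OrderDual.ofDual p.1.1

/-- The second coordinate. -/
def snd (p : ZigzagPoset) : ℤ := p.1.2

/-- The point `(a, a)`. -/
def diag (a : ℤ) : ZigzagPoset := ⟨(OrderDual.toDual a, a), Or.inl rfl⟩

/-- The point `(b + 1, b)`. -/
def sub (b : ℤ) : ZigzagPoset := ⟨(OrderDual.toDual (b + 1), b), Or.inr rfl⟩

lemma fst_eq (p : ZigzagPoset) : p.fst = p.snd ∨ p.fst = p.snd + 1 := p.2

lemma le_def (p q : ZigzagPoset) : p ≤ q ↔ q.fst ≤ p.fst ∧ p.snd ≤ q.snd := Iff.rfl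

lemma ext' {p q : ZigzagPoset} (h₁ : p.fst = q.fst) (h₂ : p.snd = q.snd) : p = q :=
  Subtype.ext (Prod.ext (congrArg OrderDual.toDual h₁) h₂)

/-- `[a, b]_ZZ` -/
def cc (a b : ℤ) : Set ZigzagPoset := {p | p.fst ≤ b ∧ a ≤ p.snd}

/-- `[a, b)_ZZ` -/
def co (a b : ℤ) : Set ZigzagPoset := {p | a ≤ p.snd ∧ p.snd < b}

/-- `(a, b]_ZZ` -/
def oc (a b : ℤ) : Set ZigzagPoset := {p | a < p.fst ∧ p.fst ≤ b}

/-- `(a, b)_ZZ` -/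
def oo (a b : ℤ) : Set ZigzagPoset := {p | a < p.fst ∧ p.snd < b}

end ZigzagPoset

/-! ### The covering map -/

/-- The covering map on points. With `N = n + m - 1`, a point `(b + 1, b)` with residue
`r = b mod N` goes to `r` if `r < n` and to `r + 1` otherwise; a point `(a, a)` with residue
`r = a mod N` goes to `r` if `r ≠ 0` and to `N` otherwise. -/
def coveringFun (n m : ℕ) [hn : Fact (1 < n)] [hm : Fact (1 < m)] (p : ZigzagPoset) : Bipath n m where
  val :=
    if p.fst = p.snd + 1 then
      if p.snd % ((n : ℤ) + m - 1) < n then (p.snd % ((n : ℤ) + m - 1)).toNat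
      else (p.snd % ((n : ℤ) + m - 1)).toNat + 1
    else
      if p.snd % ((n : ℤ) + m - 1) = 0 then n + m - 1
      else (p.snd % ((n : ℤ) + m - 1)).toNat
  isLt := by
    have h1 := hn.out
    have h2 := hm.out
    have h3 := Int.emod_nonneg p.snd (b := (n : ℤ) + m - 1) (by omega)
    have h4 := Int.emod_lt_of_pos p.snd (b := (n : ℤ) + m - 1) (by omega)
    split_ifs <;> omega

section Covering

variable {n m : ℕ} [hn : Fact (1 < n)] [hm : Fact (1 < m)]

lemma emod_eq_of_eq {N k r x : ℤ} (hx : x = k * N + r) (h0 : 0 ≤ r) (h1 : r < N) : x % N = r := by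
  rw [hx, add_comm, Int.add_mul_emod_self_right, Int.emod_eq_of_lt h0 h1]

/-! The next lemmas evaluate the covering map: with `N = n + m - 1` and `k` an integer,
`(kN + 1, kN) ↦ 0`; `(kN + i, kN + i), (kN + i + 1, kN + i) ↦ i` for `1 ≤ i ≤ n - 1`;
`(kN + n, kN + n) ↦ n`; and
`(kN - i + 1, kN - i), (kN - i + 1, kN - i + 1) ↦ n + m - i` for `1 ≤ i ≤ m - 1`. -/

lemma coveringFun_sub_zero (k : ℤ) :
    (coveringFun n m (.sub (k * ((n : ℤ) + m - 1)))).val = 0 := by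
  have h1 := hn.out
  have h2 := hm.out
  have h : (ZigzagPoset.sub (k * ((n : ℤ) + m - 1))).snd % ((n : ℤ) + m - 1) = 0 :=
    emod_eq_of_eq (k := k) (by simp [ZigzagPoset.sub, ZigzagPoset.snd]) le_rfl (by omega)
  have hf : (ZigzagPoset.sub (k * ((n : ℤ) + m - 1))).fst
    = (ZigzagPoset.sub (k * ((n : ℤ) + m - 1))).snd + 1 := rfl
  simp only [coveringFun, h, hf, if_true]
  split_ifs <;> omega

lemma coveringFun_diag_top (k : ℤ) (i : ℕ) (h0 : 1 ≤ i) (hi : i ≤ n) :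
    (coveringFun n m (.diag (k * ((n : ℤ) + m - 1) + i))).val = i := by
  have h1 := hn.out
  have h2 := hm.out
  have h : (ZigzagPoset.diag (k * ((n : ℤ) + m - 1) + i)).snd % ((n : ℤ) + m - 1) = i :=
    emod_eq_of_eq (k := k) rfl (by omega) (by omega)
  have hf : (ZigzagPoset.diag (k * ((n : ℤ) + m - 1) + i)).fst
    = (ZigzagPoset.diag (k * ((n : ℤ) + m - 1) + i)).snd := rfl
  simp only [coveringFun, h, hf]
  split_ifs <;> omega

lemma coveringFun_sub_top (k : ℤ) (i : ℕ) (hi : i < n) :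
    (coveringFun n m (.sub (k * ((n : ℤ) + m - 1) + i))).val = i := by
  have h1 := hn.out
  have h2 := hm.out
  have h : (ZigzagPoset.sub (k * ((n : ℤ) + m - 1) + i)).snd % ((n : ℤ) + m - 1) = i :=
    emod_eq_of_eq (k := k) rfl (by omega) (by omega)
  have hf : (ZigzagPoset.sub (k * ((n : ℤ) + m - 1) + i)).fst
    = (ZigzagPoset.sub (k * ((n : ℤ) + m - 1) + i)).snd + 1 := rfl
  simp only [coveringFun, h, hf, if_true]
  split_ifs <;> omega

lemma coveringFun_sub_bottom (k : ℤ) (i : ℕ) (h0 : 1 ≤ i) (hi : i < m) :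
    (coveringFun n m (.sub (k * ((n : ℤ) + m - 1) - i))).val = n + m - i := by
  have h1 := hn.out
  have h2 := hm.out
  have h : (ZigzagPoset.sub (k * ((n : ℤ) + m - 1) - i)).snd % ((n : ℤ) + m - 1)
      = (n : ℤ) + m - 1 - i :=
    emod_eq_of_eq (k := k - 1) (by simp only [ZigzagPoset.sub, ZigzagPoset.snd]; ring) (by omega) (by omega)
  have hf : (ZigzagPoset.sub (k * ((n : ℤ) + m - 1) - i)).fst
    = (ZigzagPoset.sub (k * ((n : ℤ) + m - 1) - i)).snd + 1 := rfl
  simp only [coveringFun, h, hf, if_true]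
  split_ifs <;> omega

lemma coveringFun_diag_bottom (k : ℤ) (i : ℕ) (h0 : 1 ≤ i) (hi : i < m) :
    (coveringFun n m (.diag (k * ((n : ℤ) + m - 1) - i + 1))).val = n + m - i := by
  have h1 := hn.out
  have h2 := hm.out
  have hf : (ZigzagPoset.diag (k * ((n : ℤ) + m - 1) - i + 1)).fst
    = (ZigzagPoset.diag (k * ((n : ℤ) + m - 1) - i + 1)).snd := rfl
  by_cases hi1 : i = 1
  · have h : (ZigzagPoset.diag (k * ((n : ℤ) + m - 1) - i + 1)).snd % ((n : ℤ) + m - 1) = 0 :=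
      emod_eq_of_eq (k := k) (by simp [ZigzagPoset.diag, ZigzagPoset.snd, hi1]) le_rfl (by omega)
    simp only [coveringFun, h, hf]
    split_ifs <;> omega
  · have h : (ZigzagPoset.diag (k * ((n : ℤ) + m - 1) - i + 1)).snd % ((n : ℤ) + m - 1)
        = (n : ℤ) + m - i :=
      emod_eq_of_eq (k := k - 1) (by simp only [ZigzagPoset.diag, ZigzagPoset.snd]; ring)
        (by omega) (by omega)
    simp only [coveringFun, h, hf]
    split_ifs <;> omega

lemma coveringFun_mono : Monotone (coveringFun n m) := by
  intro p q hpq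
  have h1 := hn.out
  have h2 := hm.out
  rw [ZigzagPoset.le_def] at hpq
  have hp := p.fst_eq
  have hq := q.fst_eq
  have h3 := Int.emod_nonneg p.snd (b := (n : ℤ) + m - 1) (by omega)
  have h4 := Int.emod_lt_of_pos p.snd (b := (n : ℤ) + m - 1) (by omega)
  by_cases hs : p.snd = q.snd
  · rw [Bipath.le_def]
    simp only [coveringFun, ← hs]
    split_ifs <;> omega
  · have hs' : q.snd = p.snd + 1 := by omega
    have hdiv := Int.mul_ediv_add_emod p.snd ((n : ℤ) + m - 1)
    have key : q.snd % ((n : ℤ) + m - 1) = p.snd % ((n : ℤ) + m - 1) + 1 ∨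
        (q.snd % ((n : ℤ) + m - 1) = 0 ∧
          p.snd % ((n : ℤ) + m - 1) = (n : ℤ) + m - 2) := by
      by_cases hr : p.snd % ((n : ℤ) + m - 1) = (n : ℤ) + m - 2
      · refine Or.inr ⟨emod_eq_of_eq (k := p.snd / ((n : ℤ) + m - 1) + 1) ?_ le_rfl (by omega), hr⟩
        rw [hs']
        linear_combination -hdiv + hr
      · refine Or.inl (emod_eq_of_eq (k := p.snd / ((n : ℤ) + m - 1)) ?_ (by omega) (by omega))
        rw [hs']
        linear_combination -hdiv
    rw [Bipath.le_def]
    simp only [coveringFun]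
    rcases key with h | ⟨h, h'⟩
    · rw [h]
      split_ifs <;> omega
    · rw [h, h']
      split_ifs <;> omega

end Covering

/-- The covering map `ζ` from the zigzag poset to the bipath poset. -/
def coveringMap (n m : ℕ) [Fact (1 < n)] [Fact (1 < m)] : ZigzagPoset →o Bipath n m :=
  ⟨coveringFun n m, coveringFun_mono⟩

/-! ### The finite slice -/

/-- The finite slice `(-m + 1, n + m)_ZZ` of the zigzag poset. -/
abbrev Slice (n m : ℕ) : Type := ZigzagPoset.oo (-(m : ℤ) + 1) ((n : ℤ) + m)

instance (n m : ℕ) : Finite (Slice n m) := by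
  refine Finite.of_injective
    (β := Set.Icc (-(m : ℤ)) ((n : ℤ) + m + 1) × Set.Icc (-(m : ℤ)) ((n : ℤ) + m + 1))
    (fun p => (⟨p.1.fst, ?_⟩, ⟨p.1.snd, ?_⟩)) ?_
  · have h1 := p.1.fst_eq
    have h2 : -(m : ℤ) + 1 < p.1.fst ∧ p.1.snd < (n : ℤ) + m := p.2
    constructor <;> omega
  · have h1 := p.1.fst_eq
    have h2 : -(m : ℤ) + 1 < p.1.fst ∧ p.1.snd < (n : ℤ) + m := p.2
    constructor <;> omega
  · intro p q h
    exact Subtype.ext (ZigzagPoset.ext' (congrArg (fun x => x.1.1) h)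
      (congrArg (fun x => x.2.1) h))

/-- The restriction of the covering map to the slice. -/
def sliceCoveringMap (n m : ℕ) [Fact (1 < n)] [Fact (1 < m)] : Slice n m →o Bipath n m :=
  (coveringMap n m).comp (OrderHom.Subtype.val _)

/-- The restriction functor along the covering map of the slice, `M ↦ M ∘ ζ`. -/
def sliceRestriction (k : Type u) [Field k] (n m : ℕ) [Fact (1 < n)] [Fact (1 < m)] :
    PersistenceModule k (Bipath n m) ⥤ PersistenceModule k (Slice n m) :=
  (Functor.whiskeringLeft _ _ _).obj (sliceCoveringMap n m).monotone.functor

section SliceIntervals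

variable {n m : ℕ}

/-- A nonempty set of points of the slice cut out by bounds on the sum of the coordinates is an
interval; all intervals of the slice below arise in this way. -/
def sliceIntervalOf (n m : ℕ) (S : Set (Slice n m)) (hne : S.Nonempty) (s t : ℤ)
    (hS : ∀ p : Slice n m, p ∈ S ↔ s ≤ p.1.fst + p.1.snd ∧ p.1.fst + p.1.snd ≤ t) :
    PosetInterval (Slice n m) where
  carrier := S
  nonempty := hne
  convex p hp q hq z hpz hzq := by
    rw [hS] at hp hq ⊢
    have h1 : z.1.fst ≤ p.1.fst ∧ p.1.snd ≤ z.1.snd := hpz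
    have h2 : q.1.fst ≤ z.1.fst ∧ z.1.snd ≤ q.1.snd := hzq
    have h3 := p.1.fst_eq
    have h4 := q.1.fst_eq
    have h5 := z.1.fst_eq
    omega
  connected := by
    have up : ∀ (d : ℕ) (p q : S), q.1.1.fst + q.1.1.snd = p.1.1.fst + p.1.1.snd + d →
        Relation.ReflTransGen (fun x y : S => x ≤ y ∨ y ≤ x) p q := by
      intro d
      induction d with
      | zero =>
        intro p q h
        have h3 := p.1.1.fst_eq
        have h4 := q.1.1.fst_eq
        have : p = q := Subtype.ext (Subtype.ext (ZigzagPoset.ext' (by omega) (by omega)))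
        rw [this]
      | succ d ih =>
        intro p q h
        push_cast at h
        have hq := (hS q.1).1 q.2
        have hp := (hS p.1).1 p.2
        have hqs : -(m : ℤ) + 1 < q.1.1.fst ∧ q.1.1.snd < (n : ℤ) + m := q.1.2
        have hps : -(m : ℤ) + 1 < p.1.1.fst ∧ p.1.1.snd < (n : ℤ) + m := p.1.2
        have h3 := p.1.1.fst_eq
        rcases q.1.1.fst_eq with h4 | h4
        · let z' : ZigzagPoset := .sub (q.1.1.snd - 1)
          have e1 : z'.fst = q.1.1.snd - 1 + 1 := rfl
          have e2 : z'.snd = q.1.1.snd - 1 := rfl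
          have hz : z' ∈ ZigzagPoset.oo (-(m : ℤ) + 1) ((n : ℤ) + m) := by
            constructor <;> omega
          have hzS : (⟨z', hz⟩ : Slice n m) ∈ S := (hS _).2 (by
            show s ≤ z'.fst + z'.snd ∧ z'.fst + z'.snd ≤ t
            omega)
          refine (ih p ⟨⟨z', hz⟩, hzS⟩ ?_).tail (Or.inl ?_)
          · show z'.fst + z'.snd = _
            omega
          · show q.1.1.fst ≤ z'.fst ∧ z'.snd ≤ q.1.1.snd
            omega
        · let z' : ZigzagPoset := .diag q.1.1.snd
          have e1 : z'.fst = q.1.1.snd := rfl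
          have e2 : z'.snd = q.1.1.snd := rfl
          have hz : z' ∈ ZigzagPoset.oo (-(m : ℤ) + 1) ((n : ℤ) + m) := by
            constructor <;> omega
          have hzS : (⟨z', hz⟩ : Slice n m) ∈ S := (hS _).2 (by
            show s ≤ z'.fst + z'.snd ∧ z'.fst + z'.snd ≤ t
            omega)
          refine (ih p ⟨⟨z', hz⟩, hzS⟩ ?_).tail (Or.inr ?_)
          · show z'.fst + z'.snd = _
            omega
          · show z'.fst ≤ q.1.1.fst ∧ q.1.1.snd ≤ z'.snd
            omega
    intro p q
    rcases le_total (p.1.1.fst + p.1.1.snd) (q.1.1.fst + q.1.1.snd) with h | h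
    · exact up (q.1.1.fst + q.1.1.snd - (p.1.1.fst + p.1.1.snd)).toNat p q (by omega)
    · have := up (p.1.1.fst + p.1.1.snd - (q.1.1.fst + q.1.1.snd)).toNat q p (by omega)
      have hs : Std.Symm (fun x y : S => x ≤ y ∨ y ≤ x) := ⟨fun x y hxy => hxy.symm⟩
      exact Std.Symm.symm _ _ this

/-- `[a, b]_ZZ`, as an interval of the slice. -/
def sliceCC (n m : ℕ) (a b : ℤ) (h : (Subtype.val ⁻¹' ZigzagPoset.cc a b : Set (Slice n m)).Nonempty) :
    PosetInterval (Slice n m) :=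
  sliceIntervalOf n m (Subtype.val ⁻¹' ZigzagPoset.cc a b) h (2 * a) (2 * b) fun p => by
    have := p.1.fst_eq
    change p.1.fst ≤ b ∧ a ≤ p.1.snd ↔ _
    omega

/-- `[a, b)_ZZ`, as an interval of the slice. -/
def sliceCO (n m : ℕ) (a b : ℤ) (h : (Subtype.val ⁻¹' ZigzagPoset.co a b : Set (Slice n m)).Nonempty) :
    PosetInterval (Slice n m) :=
  sliceIntervalOf n m (Subtype.val ⁻¹' ZigzagPoset.co a b) h (2 * a) (2 * b - 1) fun p => by
    have := p.1.fst_eq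
    change a ≤ p.1.snd ∧ p.1.snd < b ↔ _
    omega

/-- `(a, b]_ZZ`, as an interval of the slice. -/
def sliceOC (n m : ℕ) (a b : ℤ) (h : (Subtype.val ⁻¹' ZigzagPoset.oc a b : Set (Slice n m)).Nonempty) :
    PosetInterval (Slice n m) :=
  sliceIntervalOf n m (Subtype.val ⁻¹' ZigzagPoset.oc a b) h (2 * a + 1) (2 * b) fun p => by
    have := p.1.fst_eq
    change a < p.1.fst ∧ p.1.fst ≤ b ↔ _
    omega

/-- `(a, b)_ZZ`, as an interval of the slice. -/
def sliceOO (n m : ℕ) (a b : ℤ) (h : (Subtype.val ⁻¹' ZigzagPoset.oo a b : Set (Slice n m)).Nonempty) :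
    PosetInterval (Slice n m) :=
  sliceIntervalOf n m (Subtype.val ⁻¹' ZigzagPoset.oo a b) h (2 * a + 1) (2 * b - 1) fun p => by
    have := p.1.fst_eq
    change a < p.1.fst ∧ p.1.snd < b ↔ _
    omega

/-- The set `[a, b]_ZZ` meets the slice as soon as it contains a point `(x, x)` of the slice;
similarly for the lemmas below. -/
lemma sliceCC_nonempty (a b x : ℤ) (h₁ : a ≤ x) (h₂ : x ≤ b) (h₃ : -(m : ℤ) + 1 < x)
    (h₄ : x < (n : ℤ) + m) : (Subtype.val ⁻¹' ZigzagPoset.cc a b : Set (Slice n m)).Nonempty :=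
  ⟨⟨.diag x, h₃, h₄⟩, h₂, h₁⟩

lemma sliceCO_nonempty (a b x : ℤ) (h₁ : a ≤ x) (h₂ : x < b) (h₃ : -(m : ℤ) + 1 < x)
    (h₄ : x < (n : ℤ) + m) : (Subtype.val ⁻¹' ZigzagPoset.co a b : Set (Slice n m)).Nonempty :=
  ⟨⟨.diag x, h₃, h₄⟩, h₁, h₂⟩

lemma sliceOC_nonempty (a b x : ℤ) (h₁ : a < x) (h₂ : x ≤ b) (h₃ : -(m : ℤ) + 1 < x)
    (h₄ : x < (n : ℤ) + m) : (Subtype.val ⁻¹' ZigzagPoset.oc a b : Set (Slice n m)).Nonempty :=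
  ⟨⟨.diag x, h₃, h₄⟩, h₁, h₂⟩

lemma sliceOO_nonempty (a b x : ℤ) (h₁ : a ≤ x) (h₂ : x < b) (h₃ : -(m : ℤ) + 1 ≤ x)
    (h₄ : x < (n : ℤ) + m) : (Subtype.val ⁻¹' ZigzagPoset.oo a b : Set (Slice n m)).Nonempty :=
  ⟨⟨.sub x, Int.lt_add_one_of_le h₃, h₄⟩, Int.lt_add_one_of_le h₁, h₂⟩

end SliceIntervals

/-! The sets of the correspondence between bipath intervals and slice intervals meet the slice. -/

section NonemptyRows

variable {n m : ℕ} [hn : Fact (1 < n)] [hm : Fact (1 < m)]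

lemma fullRow_nonempty : (Subtype.val ⁻¹' ZigzagPoset.oo (-(m : ℤ) + 1) ((n : ℤ) + m) :
    Set (Slice n m)).Nonempty := by
  have h1 := hn.out
  have h2 := hm.out
  exact sliceOO_nonempty _ _ 0 (by omega) (by omega) (by omega) (by omega)

lemma leftZeroRow_nonempty (i : Bipath n m) :
    (Subtype.val ⁻¹' ZigzagPoset.oo 0 ((i.val : ℤ) + 1) : Set (Slice n m)).Nonempty := by
  have h1 := hn.out
  have h2 := hm.out
  exact sliceOO_nonempty _ _ 0 (by omega) (by omega) (by omega) (by omega)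

lemma leftRow_nonempty (i j : Bipath n m) :
    (Subtype.val ⁻¹' ZigzagPoset.oo (-(n : ℤ) - m + j.val) ((i.val : ℤ) + 1) :
      Set (Slice n m)).Nonempty := by
  have h1 := hn.out
  have h2 := hm.out
  have h3 := j.isLt
  exact sliceOO_nonempty _ _ 0 (by omega) (by omega) (by omega) (by omega)

lemma rightRow_nonempty (i j : Bipath n m) (hi : 0 < i.val ∧ i.val ≤ n) (hj : n ≤ j.val) :
    (Subtype.val ⁻¹' ZigzagPoset.cc (i.val : ℤ) (j.val : ℤ) : Set (Slice n m)).Nonempty := by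
  have h2 := hm.out
  exact sliceCC_nonempty _ _ i.val (by omega) (by omega) (by omega) (by omega)

lemma topRow_nonempty (i j : Bipath n m) (hij : i.val ≤ j.val) :
    (Subtype.val ⁻¹' ZigzagPoset.co (i.val : ℤ) ((j.val : ℤ) + 1) : Set (Slice n m)).Nonempty := by
  have h2 := hm.out
  have h3 := i.isLt
  exact sliceCO_nonempty _ _ i.val (by omega) (by omega) (by omega) (by omega)

lemma bottomRow_nonempty (i j : Bipath n m) (hij : i.val ≤ j.val) :
    (Subtype.val ⁻¹' ZigzagPoset.oc ((i.val : ℤ) - 1) (j.val : ℤ) : Set (Slice n m)).Nonempty := by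
  have h2 := hm.out
  have h3 := i.isLt
  exact sliceOC_nonempty _ _ i.val (by omega) (by omega) (by omega) (by omega)

end NonemptyRows

end

/-! Decompositions are handled through explicit bases. A direct sum decomposition of `M` into
interval modules amounts to an `IntervalBasis`: vectors and functionals supported on intervals,
compatible with the structure maps and dual to each other at every point (`isBarcode_iff`). Two
interval bases contain every interval `I` equally often (`IntervalBasis.card_le`): a composite `k I
⟶ k K ⟶ k I` is zero unless `K = I`, so at a point of `I` the `I`-blocks of the two base changes
compose to the identity. This gives uniqueness of barcodes.

Existence over the bipath poset is an induction on total dimension that splits off one interval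
summand at a time (`exists_intervalBasis`, `exists_isBipathInterval_summand`). If the map from `0`
to `n` is nonzero, the full interval splits off. If it is zero, a nonzero space at `0` gives a left
interval by comparing the two flags of kernels, and a nonzero space at `n` gives a right interval by
comparing the two flags of images. If both end spaces vanish, `M` lives on two disjoint chains,
where a class is followed from birth to death. Applied to the module `k I` itself, the same
decomposition shows that every interval `I` is a listed one (`isBipathInterval`).

For the restriction, `k I` composed with the covering map is the direct sum of the interval modules
of the connected components of the preimage of `I`. A basis of `M` therefore yields a basis of the
restriction (`IntervalBasis.restrictAlong`), and the multiplicity of a slice interval `C` counts the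
basis intervals of `M` whose preimage has `C` as a component. The slice is a fence on which the
covering map walks down the bottom chain from `n + 1` to `0`, up the top chain to `n`, and down the
bottom chain to `0` again. Some components of preimages are shared by several intervals, but each
slice interval of the theorem comes from exactly one `I` (`isComponent_preimage_iff`), so that the
two multiplicities agree (`IntervalBasis.barcode_restrictAlong`). -/

noncomputable section

/-! ### Structure maps as linear maps -/

section StructureMaps

variable {k : Type u} [Field k] {P : Type v} [Preorder P]

/-- The structure map of a persistence module, as a linear map. -/
def CategoryTheory.Functor.linearMap (M : PersistenceModule k P) {p q : P} (h : p ≤ q) :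
    M.obj p →ₗ[k] M.obj q :=
  (M.map (homOfLE h)).hom.hom

lemma linearMap_linearMap (M : PersistenceModule k P) {p q r : P} (h : p ≤ q) (h' : q ≤ r)
    (x : M.obj p) : M.linearMap h' (M.linearMap h x) = M.linearMap (h.trans h') x := by
  have : M.map (homOfLE (h.trans h')) = M.map (homOfLE h) ≫ M.map (homOfLE h') := by
    rw [← M.map_comp]
    rfl
  simp only [Functor.linearMap, this]
  rfl

lemma linearMap_self (M : PersistenceModule k P) {p : P} (h : p ≤ p) (x : M.obj p) :
    M.linearMap h x = x := by
  have : M.map (homOfLE h) = 𝟙 _ := by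
    rw [← M.map_id]
    rfl
  simp only [Functor.linearMap, this]
  rfl

lemma app_linearMap {M N : PersistenceModule k P} (α : M ⟶ N) {p q : P} (h : p ≤ q)
    (x : M.obj p) :
    (α.app q).hom.hom (M.linearMap h x) = N.linearMap h ((α.app p).hom.hom x) := by
  have h1 := α.naturality (homOfLE h)
  have h2 := congrArg (fun f => f.hom.hom x) h1
  exact h2

/-- A natural transformation given by linear maps commuting with the structure maps. -/
def natTransOfLinearMap {M N : PersistenceModule k P} (f : ∀ p, M.obj p →ₗ[k] N.obj p)
    (hf : ∀ p q (h : p ≤ q) x, f q (M.linearMap h x) = N.linearMap h (f p x)) : M ⟶ N where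
  app p := FGModuleCat.ofHom (f p)
  naturality p q g := by
    apply FGModuleCat.hom_ext
    ext x
    exact hf p q (leOfHom g) x

end StructureMaps

/-! ### Interval bases -/

section IntervalBasis

variable {k : Type u} [Field k] {P : Type v} [Preorder P]

/-- An interval basis of `M`: vectors `vec x p` and functionals `coord x p` supported on intervals
`J x` and compatible with the structure maps, which at every `p` restrict to a basis of `M.obj p`
and its dual basis. -/
structure IntervalBasis (M : PersistenceModule k P) {ι : Type*} [Fintype ι]
    (J : ι → PosetInterval P) where
  vec : ι → ∀ p, M.obj p
  coord : ι → ∀ p, M.obj p →ₗ[k] k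
  map_vec : ∀ x p q (h : p ≤ q), p ∈ (J x).carrier → M.linearMap h (vec x p) = vec x q
  vec_eq_zero : ∀ x p, p ∉ (J x).carrier → vec x p = 0
  coord_map : ∀ x p q (h : p ≤ q), q ∈ (J x).carrier →
    ∀ v, coord x q (M.linearMap h v) = coord x p v
  coord_eq_zero : ∀ x p, p ∉ (J x).carrier → coord x p = 0
  coord_self : ∀ x p, p ∈ (J x).carrier → coord x p (vec x p) = 1
  coord_ne : ∀ x y p, x ≠ y → coord x p (vec y p) = 0
  total : ∀ p v, ∑ x, coord x p v • vec x p = v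

/-- Reindexing an interval basis along an equivalence. -/
def IntervalBasis.reindex {M : PersistenceModule k P} {ι κ : Type*} [Fintype ι] [Fintype κ]
    {J : ι → PosetInterval P} {K : κ → PosetInterval P} (b : IntervalBasis M J) (σ : κ ≃ ι)
    (hσ : ∀ x, J (σ x) = K x) : IntervalBasis M K where
  vec x := b.vec (σ x)
  coord x := b.coord (σ x)
  map_vec x p q h hp := b.map_vec _ _ _ h (by rwa [hσ])
  vec_eq_zero x p hp := b.vec_eq_zero _ _ (by rwa [hσ])
  coord_map x p q h hq := b.coord_map _ _ _ h (by rwa [hσ])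
  coord_eq_zero x p hp := b.coord_eq_zero _ _ (by rwa [hσ])
  coord_self x p hp := b.coord_self _ _ (by rwa [hσ])
  coord_ne x y p h := b.coord_ne _ _ _ (by simpa using h)
  total p v := by
    exact (σ.sum_comp fun y => b.coord y p v • b.vec y p).trans (b.total p v)

/-- A subset closed under comparability in an interval and meeting it is the whole interval. -/
lemma PosetInterval.subset_of_closed (I : PosetInterval P) (S : Set P) {p : P} (hpI : p ∈ I.carrier)
    (hpS : p ∈ S) (h : ∀ a ∈ I.carrier, ∀ b ∈ I.carrier, a ∈ S → (a ≤ b ∨ b ≤ a) → b ∈ S) :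
    I.carrier ⊆ S := by
  intro q hq
  suffices ∀ r : I.carrier, r.1 ∈ S from this ⟨q, hq⟩
  intro r
  induction I.connected ⟨p, hpI⟩ r with
  | refl => exact hpS
  | @tail b c _ hbc ih => exact h b b.2 c c.2 ih hbc

/-- The coordinates of a vector of one interval basis with respect to another one are constant
along comparable points. -/
lemma IntervalBasis.coord_vec_eq {M : PersistenceModule k P} {ι κ : Type*} [Fintype ι] [Fintype κ]
    {J : ι → PosetInterval P} {K : κ → PosetInterval P} (b : IntervalBasis M J)
    (c : IntervalBasis M K) (x : ι) (y : κ) {p q : P} (h : p ≤ q) (hp : p ∈ (J x).carrier)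
    (hq : q ∈ (K y).carrier) : c.coord y q (b.vec x q) = c.coord y p (b.vec x p) := by
  rw [← b.map_vec x p q h hp, c.coord_map y p q h hq]

lemma IntervalBasis.mem_of_coord_vec_ne_zero {M : PersistenceModule k P} {ι κ : Type*} [Fintype ι]
    [Fintype κ] {J : ι → PosetInterval P} {K : κ → PosetInterval P} (b : IntervalBasis M J)
    (c : IntervalBasis M K) (x : ι) (y : κ) {p : P} (h : c.coord y p (b.vec x p) ≠ 0) :
    p ∈ (J x).carrier ∧ p ∈ (K y).carrier := by
  constructor <;> by_contra hp
  · exact h (by rw [b.vec_eq_zero x p hp, map_zero])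
  · exact h (by rw [c.coord_eq_zero y p hp, LinearMap.zero_apply])

/-- Maps `k I ⟶ k K ⟶ k I` compose to zero unless `I = K`. -/
lemma IntervalBasis.eq_of_coord_vec_ne_zero {M : PersistenceModule k P} {ι κ : Type*} [Fintype ι]
    [Fintype κ] {J : ι → PosetInterval P} {K : κ → PosetInterval P} (b : IntervalBasis M J)
    (c : IntervalBasis M K) {x x' : ι} {y : κ} (hx : J x = J x') {p : P}
    (h : c.coord y p (b.vec x p) ≠ 0) (h' : b.coord x' p (c.vec y p) ≠ 0) : K y = J x := by
  -- Within the intersection of the two intervals, `S` is closed under comparability. What remains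
  -- is that no step leads from `S` to a point of just one of the intervals.
  let S : Set P := {q | c.coord y q (b.vec x q) ≠ 0 ∧ b.coord x' q (c.vec y q) ≠ 0}
  have hS : ∀ q ∈ S, q ∈ (J x).carrier ∧ q ∈ (K y).carrier := fun q hq =>
    b.mem_of_coord_vec_ne_zero c x y hq.1
  have key : ∀ a r, a ∈ S → (a ≤ r ∨ r ≤ a) → r ∈ (J x).carrier → r ∈ (K y).carrier → r ∈ S := by
    rintro a r ha (har | har) h1 h2
    · refine ⟨?_, ?_⟩
      · rw [b.coord_vec_eq c x y har (hS a ha).1 h2]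
        exact ha.1
      · rw [c.coord_vec_eq b y x' har (hS a ha).2 (hx ▸ h1)]
        exact ha.2
    · refine ⟨?_, ?_⟩
      · rw [← b.coord_vec_eq c x y har h1 (hS a ha).2]
        exact ha.1
      · rw [← c.coord_vec_eq b y x' har h2 (hx ▸ (hS a ha).1)]
        exact ha.2
  have hp : p ∈ S := ⟨h, h'⟩
  have h1 : (J x).carrier ⊆ S := by
    refine (J x).subset_of_closed S (hS p hp).1 hp fun a _ r hr haS har => ?_
    refine key a r haS har hr ?_
    -- Of the two scalars defining `S`, one propagates upwards and the other downwards without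
    -- knowing that `r` lies in `K y`. Being nonzero at `r`, it forces this membership.
    rcases har with har | har
    · refine (c.mem_of_coord_vec_ne_zero b y x' (p := r) ?_).1
      rw [c.coord_vec_eq b y x' har (hS a haS).2 (hx ▸ hr)]
      exact haS.2
    · refine (b.mem_of_coord_vec_ne_zero c x y (p := r) ?_).2
      rw [← b.coord_vec_eq c x y har hr (hS a haS).2]
      exact haS.1
  have h2 : (K y).carrier ⊆ S := by
    refine (K y).subset_of_closed S (hS p hp).2 hp fun a _ r hr haS har => ?_
    refine key a r haS har ?_ hr
    rcases har with har | har
    · refine (b.mem_of_coord_vec_ne_zero c x y (p := r) ?_).1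
      rw [b.coord_vec_eq c x y har (hS a haS).1 hr]
      exact haS.1
    · rw [hx]
      refine (c.mem_of_coord_vec_ne_zero b y x' (p := r) ?_).2
      rw [← c.coord_vec_eq b y x' har hr (hx ▸ (hS a haS).1)]
      exact haS.2
  ext q
  exact ⟨fun hq => (hS q (h2 hq)).1, fun hq => (hS q (h1 hq)).2⟩

-- The identity matrix indexed by the occurrences of `I` in `J` factors through the occurrences of
-- `I` in `K`, so a rank comparison gives the inequality. A single point of `I` is enough.
open Classical in
lemma IntervalBasis.card_le {M : PersistenceModule k P} {ι κ : Type*} [Fintype ι]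
    [Fintype κ] {J : ι → PosetInterval P} {K : κ → PosetInterval P} (b : IntervalBasis M J)
    (c : IntervalBasis M K) (I : PosetInterval P) :
    Fintype.card {x // J x = I} ≤ Fintype.card {y // K y = I} := by
  obtain ⟨p, hp⟩ := I.nonempty
  let A : Matrix {y // K y = I} {x // J x = I} k := .of fun y x => c.coord y p (b.vec x p)
  let B : Matrix {x // J x = I} {y // K y = I} k := .of fun x y => b.coord x p (c.vec y p)
  have hBA : B * A = 1 := by
    ext x' x
    rw [Matrix.mul_apply, Matrix.one_apply]
    have h1 : b.coord x' p (b.vec x p)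
        = ∑ y, b.coord x' p (c.vec y p) * c.coord y p (b.vec x p) := by
      conv_lhs => rw [← c.total p (b.vec x p)]
      simp [mul_comm]
    have h2 : ∑ y : {y // K y = I}, B x' y * A y x
        = ∑ y, b.coord x' p (c.vec y p) * c.coord y p (b.vec x p) := by
      -- In the sum over all `y`, a nonzero term has both factors nonzero and hence `K y = I`.
      rw [← Finset.sum_filter_of_ne (p := fun y => K y = I)]
      · exact (Finset.sum_subtype (Finset.univ.filter fun y => K y = I) (by simp)
          fun y => b.coord x' p (c.vec y p) * c.coord y p (b.vec x p)).symm
      · intro y _ hy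
        rw [b.eq_of_coord_vec_ne_zero c (x.2.trans x'.2.symm) (right_ne_zero_of_mul hy)
          (left_ne_zero_of_mul hy), x.2]
    rw [h2, ← h1]
    split_ifs with h
    · subst h
      exact b.coord_self _ _ (by rwa [x'.2])
    · exact b.coord_ne _ _ _ fun h' => h (Subtype.ext h')
  have h1 : A.rank ≤ Fintype.card {y // K y = I} := A.rank_le_card_height
  have h2 : (B * A).rank ≤ A.rank := Matrix.rank_mul_le_right B A
  rw [hBA, Matrix.rank_one] at h2
  exact h2.trans h1

end IntervalBasis

/-! ### Barcodes as interval bases, and their uniqueness. -/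

section Barcode

variable {k : Type u} [Field k] {P : Type v} [Preorder P]

/-- The inclusion of the space of the interval module at `p` into `k`. -/
def intervalModuleVal (k : Type u) [Field k] (I : PosetInterval P) (p : P) :
    (intervalModule k I).obj p →ₗ[k] k :=
  (intervalStalk k I p).subtype

lemma intervalModuleVal_injective (I : PosetInterval P) (p : P) :
    Function.Injective (intervalModuleVal k I p) :=
  Subtype.val_injective

lemma intervalModule_eq_zero {I : PosetInterval P} {p : P} (hp : p ∉ I.carrier)
    (x : (intervalModule k I).obj p) : x = 0 :=
  intervalStalk_eq_zero k I p hp x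

lemma intervalModuleVal_linearMap (I : PosetInterval P) {p q : P} (h : p ≤ q)
    (hq : q ∈ I.carrier) (x : (intervalModule k I).obj p) :
    intervalModuleVal k I q ((intervalModule k I).linearMap h x) = intervalModuleVal k I p x := by
  by_cases hp : p ∈ I.carrier
  · change (intervalMap k I p q x).1 = Subtype.val (p := (· ∈ intervalStalk k I p)) x
    rw [intervalMap, dif_pos ⟨hp, hq⟩]
    rfl
  · rw [intervalModule_eq_zero hp x, map_zero, map_zero, map_zero]

open Classical in
/-- The generator of the interval module at `p`. -/
def intervalGenerator (k : Type u) [Field k] (I : PosetInterval P) (p : P) :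
    (intervalModule k I).obj p :=
  if hp : p ∈ I.carrier then
    Subtype.mk (p := (· ∈ intervalStalk k I p)) 1 (by simp [intervalStalk, hp])
  else 0

lemma intervalModuleVal_intervalGenerator {I : PosetInterval P} {p : P} (hp : p ∈ I.carrier) :
    intervalModuleVal k I p (intervalGenerator k I p) = 1 := by
  have h : intervalGenerator k I p = Subtype.mk (p := (· ∈ intervalStalk k I p)) 1 _ := dif_pos hp
  rw [h]
  rfl

lemma intervalModuleVal_smul (I : PosetInterval P) (p : P) (x : (intervalModule k I).obj p) :
    intervalModuleVal k I p x • intervalGenerator k I p = x := by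
  by_cases hp : p ∈ I.carrier
  · apply intervalModuleVal_injective
    rw [map_smul, intervalModuleVal_intervalGenerator hp, smul_eq_mul, mul_one]
  · rw [intervalModule_eq_zero hp x, map_zero, zero_smul]

lemma linearMap_intervalGenerator (I : PosetInterval P) {p q : P} (h : p ≤ q)
    (hp : p ∈ I.carrier) :
    (intervalModule k I).linearMap h (intervalGenerator k I p) = intervalGenerator k I q := by
  by_cases hq : q ∈ I.carrier
  · apply intervalModuleVal_injective
    rw [intervalModuleVal_linearMap I h hq, intervalModuleVal_intervalGenerator hp,
      intervalModuleVal_intervalGenerator hq]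
  · rw [intervalModule_eq_zero hq (intervalGenerator k I q)]
    exact intervalModule_eq_zero hq _

lemma natTrans_ext_apply {M N : PersistenceModule k P} {α β : M ⟶ N}
    (h : ∀ p x, (α.app p).hom.hom x = (β.app p).hom.hom x) : α = β := by
  ext p : 2
  apply FGModuleCat.hom_ext
  ext x
  exact h p x

lemma sum_app_apply {M N : PersistenceModule k P} {ι : Type*} (s : Finset ι) (α : ι → (M ⟶ N))
    (p : P) (x : M.obj p) :
    ((∑ i ∈ s, α i).app p).hom.hom x = ∑ i ∈ s, ((α i).app p).hom.hom x := by
  let F : (M ⟶ N) →+ N.obj p :=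
    { toFun := fun α => (α.app p).hom.hom x
      map_zero' := rfl
      map_add' := fun _ _ => rfl }
  exact map_sum F α s

/-- The interval basis of a finite direct sum decomposition into interval modules. -/
def IntervalBasis.ofTotal {M : PersistenceModule k P} {ι : Type*} [Fintype ι]
    {J : ι → PosetInterval P} (α : ∀ x, intervalModule k (J x) ⟶ M)
    (β : ∀ x, M ⟶ intervalModule k (J x)) (h : ∀ x, α x ≫ β x = 𝟙 _)
    (h0 : ∀ x y, x ≠ y → α x ≫ β y = 0) (ht : ∑ x, β x ≫ α x = 𝟙 M) :
    IntervalBasis M J where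
  vec x p := ((α x).app p).hom.hom (intervalGenerator k (J x) p)
  coord x p := intervalModuleVal k (J x) p ∘ₗ ((β x).app p).hom.hom
  map_vec x p q hpq hp := by
    rw [← app_linearMap (α x) hpq, linearMap_intervalGenerator _ hpq hp]
  vec_eq_zero x p hp := by
    rw [intervalModule_eq_zero hp (intervalGenerator k (J x) p), map_zero]
  coord_map x p q hpq hq v := by
    rw [LinearMap.comp_apply, LinearMap.comp_apply, app_linearMap (β x) hpq,
      intervalModuleVal_linearMap _ _ hq]
  coord_eq_zero x p hp := by
    ext v
    rw [LinearMap.comp_apply, intervalModule_eq_zero hp (((β x).app p).hom.hom v), map_zero]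
    rfl
  coord_self x p hp := by
    have := congrArg (fun f => intervalModuleVal k (J x) p
      ((f.app p).hom.hom (intervalGenerator k (J x) p))) (h x)
    exact this.trans (intervalModuleVal_intervalGenerator hp)
  coord_ne x y p hxy := by
    have := congrArg (fun f => intervalModuleVal k (J x) p
      ((f.app p).hom.hom (intervalGenerator k (J y) p))) (h0 y x hxy.symm)
    exact this.trans (map_zero _)
  total p v := by
    have := congrArg (fun f => (f.app p).hom.hom v) ht
    refine Eq.trans ?_ this
    rw [sum_app_apply]
    refine Finset.sum_congr rfl fun x _ => ?_
    rw [← map_smul, LinearMap.comp_apply, intervalModuleVal_smul]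
    rfl

namespace IntervalBasis

variable {M : PersistenceModule k P} {ι : Type*} [Fintype ι] {J : ι → PosetInterval P}
  (b : IntervalBasis M J)

/-- The inclusion of an interval summand. -/
def incl (x : ι) : intervalModule k (J x) ⟶ M :=
  natTransOfLinearMap
    (fun p => LinearMap.toSpanSingleton k (M.obj p) (b.vec x p) ∘ₗ intervalModuleVal k (J x) p)
    (by
      intro p q hpq v
      rw [LinearMap.comp_apply, LinearMap.comp_apply, LinearMap.toSpanSingleton_apply,
        LinearMap.toSpanSingleton_apply, map_smul]
      by_cases hp : p ∈ (J x).carrier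
      · rw [b.map_vec x p q hpq hp]
        by_cases hq : q ∈ (J x).carrier
        · rw [intervalModuleVal_linearMap _ hpq hq]
        · rw [b.vec_eq_zero x q hq, smul_zero, smul_zero]
      · simp only [intervalModule_eq_zero hp v, map_zero, zero_smul])

/-- The projection to an interval summand. -/
def proj (x : ι) : M ⟶ intervalModule k (J x) :=
  natTransOfLinearMap
    (fun p => LinearMap.toSpanSingleton k _ (intervalGenerator k (J x) p) ∘ₗ b.coord x p)
    (by
      intro p q hpq v
      rw [LinearMap.comp_apply, LinearMap.comp_apply, LinearMap.toSpanSingleton_apply,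
        LinearMap.toSpanSingleton_apply, map_smul]
      by_cases hq : q ∈ (J x).carrier
      · rw [b.coord_map x p q hpq hq]
        by_cases hp : p ∈ (J x).carrier
        · rw [linearMap_intervalGenerator _ hpq hp]
        · rw [b.coord_eq_zero x p hp, LinearMap.zero_apply, zero_smul, zero_smul]
      · exact (intervalModule_eq_zero hq _).trans (intervalModule_eq_zero hq _).symm)

lemma incl_app_apply (x : ι) (p : P) (v : (intervalModule k (J x)).obj p) :
    ((b.incl x).app p).hom.hom v = intervalModuleVal k (J x) p v • b.vec x p :=
  rfl

lemma proj_app_apply (x : ι) (p : P) (v : M.obj p) :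
    ((b.proj x).app p).hom.hom v = b.coord x p v • intervalGenerator k (J x) p :=
  rfl

lemma incl_proj (x : ι) : b.incl x ≫ b.proj x = 𝟙 _ := by
  refine natTrans_ext_apply fun p v => ?_
  by_cases hp : p ∈ (J x).carrier
  · change ((b.proj x).app p).hom.hom (((b.incl x).app p).hom.hom v) = v
    rw [incl_app_apply, proj_app_apply, map_smul, b.coord_self x p hp, smul_eq_mul, mul_one,
      intervalModuleVal_smul]
  · exact (intervalModule_eq_zero hp _).trans (intervalModule_eq_zero hp _).symm

lemma incl_proj_of_ne {x y : ι} (h : x ≠ y) : b.incl x ≫ b.proj y = 0 := by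
  refine natTrans_ext_apply fun p v => ?_
  change ((b.proj y).app p).hom.hom (((b.incl x).app p).hom.hom v) = 0
  rw [incl_app_apply, proj_app_apply, map_smul, b.coord_ne y x p h.symm, smul_zero, zero_smul]

lemma sum_proj_incl : ∑ x, b.proj x ≫ b.incl x = 𝟙 M := by
  refine natTrans_ext_apply fun p v => ?_
  rw [sum_app_apply]
  refine Eq.trans (Finset.sum_congr rfl fun x _ => ?_) (b.total p v)
  change ((b.incl x).app p).hom.hom (((b.proj x).app p).hom.hom v) = _
  by_cases hp : p ∈ (J x).carrier
  · rw [incl_app_apply, proj_app_apply, map_smul, intervalModuleVal_intervalGenerator hp,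
      smul_eq_mul, mul_one]
  · rw [incl_app_apply, b.vec_eq_zero x p hp, smul_zero, smul_zero]

end IntervalBasis

lemma biproduct_total {C : Type*} [Category* C] [Preadditive C] {ι : Type*} [Fintype ι]
    (f : ι → C) [HasBiproduct f] : ∑ x, biproduct.π f x ≫ biproduct.ι f x = 𝟙 (⨁ f) := by
  classical
  refine biproduct.hom_ext _ _ fun y => ?_
  rw [Preadditive.sum_comp, Finset.sum_eq_single y]
  · simp
  · intro x _ h
    simp [biproduct.ι_π_ne _ h]
  · simp

variable [Finite P]

/-- This passes from biproducts to vectors and functionals, the form in which uniqueness and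
restriction are computed. -/
lemma isBarcode_iff {M : PersistenceModule k P} {μ : PosetInterval P → ℕ} :
    IsBarcode M μ ↔ ∃ _ : Fintype (Σ I : PosetInterval P, Fin (μ I)),
      Nonempty (IntervalBasis M fun x : Σ I : PosetInterval P, Fin (μ I) => x.1) := by
  classical
  have := Fintype.ofFinite (Σ I : PosetInterval P, Fin (μ I))
  constructor
  · rintro ⟨e⟩
    let f : (Σ I : PosetInterval P, Fin (μ I)) → PersistenceModule k P :=
      fun x => intervalModule k x.1
    refine ⟨this, ⟨IntervalBasis.ofTotal (fun x => biproduct.ι f x ≫ e.inv)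
      (fun x => e.hom ≫ biproduct.π f x) ?_ ?_ ?_⟩⟩
    · intro x
      rw [Category.assoc, e.inv_hom_id_assoc, biproduct.ι_π_self]
    · intro x y h
      rw [Category.assoc, e.inv_hom_id_assoc, biproduct.ι_π_ne _ h]
    · have h2 : ∀ x, (e.hom ≫ biproduct.π f x) ≫ biproduct.ι f x ≫ e.inv
          = e.hom ≫ (biproduct.π f x ≫ biproduct.ι f x) ≫ e.inv := by
        intro x
        simp only [Category.assoc]
      rw [Finset.sum_congr rfl fun x _ => h2 x, ← Preadditive.comp_sum, ← Preadditive.sum_comp,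
        biproduct_total, Category.id_comp, e.hom_inv_id]
  · rintro ⟨this', ⟨b⟩⟩
    obtain rfl : this = this' := Subsingleton.elim _ _
    let f : (Σ I : PosetInterval P, Fin (μ I)) → PersistenceModule k P :=
      fun x => intervalModule k x.1
    refine ⟨⟨biproduct.lift (f := f) b.proj, biproduct.desc (f := f) b.incl, ?_, ?_⟩⟩
    · rw [← Category.id_comp (biproduct.desc b.incl), ← biproduct_total f, Preadditive.sum_comp,
        Preadditive.comp_sum]
      simp only [Category.assoc, biproduct.ι_desc, biproduct.lift_π_assoc]
      exact b.sum_proj_incl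
    · refine biproduct.hom_ext' _ _ fun x => biproduct.hom_ext _ _ fun y => ?_
      rw [biproduct.ι_desc_assoc, Category.assoc, biproduct.lift_π, Category.comp_id]
      by_cases h : x = y
      · subst h
        rw [b.incl_proj, biproduct.ι_π_self]
      · rw [b.incl_proj_of_ne h, biproduct.ι_π_ne _ h]

open Classical in
lemma IntervalBasis.isBarcode {M : PersistenceModule k P} {ι : Type*} [Fintype ι]
    {J : ι → PosetInterval P} (b : IntervalBasis M J) :
    IsBarcode M fun I => Fintype.card {x // J x = I} := by
  have := Fintype.ofFinite (PosetInterval P)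
  rw [isBarcode_iff]
  refine ⟨inferInstance, ⟨b.reindex ((Equiv.sigmaCongrRight fun I =>
    (Fintype.equivFin {x // J x = I}).symm).trans (Equiv.sigmaFiberEquiv J)) ?_⟩⟩
  rintro ⟨I, x⟩
  exact ((Fintype.equivFin {x // J x = I}).symm x).2

open Classical in
lemma IntervalBasis.card_eq_of_isBarcode {M : PersistenceModule k P} {ι : Type*} [Fintype ι]
    {J : ι → PosetInterval P} (b : IntervalBasis M J) {μ : PosetInterval P → ℕ}
    (hμ : IsBarcode M μ) (I : PosetInterval P) : μ I = Fintype.card {x // J x = I} := by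
  obtain ⟨_, ⟨c⟩⟩ := isBarcode_iff.1 hμ
  have h1 : Fintype.card {x : Σ I : PosetInterval P, Fin (μ I) // x.1 = I} = μ I :=
    (Fintype.card_congr (Equiv.sigmaSubtype I)).trans (Fintype.card_fin _)
  rw [← h1]
  exact le_antisymm (c.card_le b I) (b.card_le c I)

lemma IntervalBasis.existsUnique_isBarcode {M : PersistenceModule k P} {ι : Type*} [Fintype ι]
    {J : ι → PosetInterval P} (b : IntervalBasis M J) : ∃! μ, IsBarcode M μ :=
  ⟨_, b.isBarcode, fun _ h => funext fun I => b.card_eq_of_isBarcode h I⟩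

end Barcode

/-! ### Connected components and restriction along order-preserving maps -/

section Component

variable {P : Type v} [Preorder P]

/-- The interval `C` is a connected component of `S`. -/
def PosetInterval.IsComponent (C : PosetInterval P) (S : Set P) : Prop :=
  C.carrier ⊆ S ∧ ∀ p ∈ C.carrier, ∀ q ∈ S, (p ≤ q ∨ q ≤ p) → q ∈ C.carrier

lemma PosetInterval.IsComponent.carrier_subset {C D : PosetInterval P} {S : Set P}
    (hC : C.IsComponent S) (hD : D.carrier ⊆ S) {p : P} (hpC : p ∈ C.carrier)
    (hpD : p ∈ D.carrier) : D.carrier ⊆ C.carrier :=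
  D.subset_of_closed _ hpD hpC fun a _ b hb haC hab => hC.2 a haC b (hD hb) hab

lemma PosetInterval.IsComponent.eq_of_mem {C D : PosetInterval P} {S : Set P}
    (hC : C.IsComponent S) (hD : D.IsComponent S) {p : P} (hpC : p ∈ C.carrier)
    (hpD : p ∈ D.carrier) : C = D :=
  PosetInterval.ext (Set.Subset.antisymm (hD.carrier_subset hC.1 hpD hpC)
    (hC.carrier_subset hD.1 hpC hpD))

/-- An interval has no component other than itself. -/
lemma PosetInterval.IsComponent.eq {C I : PosetInterval P} (h : C.IsComponent I.carrier) :
    C = I := by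
  obtain ⟨p, hp⟩ := C.nonempty
  exact PosetInterval.ext (Set.Subset.antisymm h.1 (h.carrier_subset Set.Subset.rfl hp (h.1 hp)))

/-- The connected component of a point in a convex set. -/
def componentOf (S : Set P) (hS : ∀ p ∈ S, ∀ q ∈ S, ∀ z, p ≤ z → z ≤ q → z ∈ S) (a : S) :
    PosetInterval P where
  carrier := {p | ∃ h : p ∈ S, Relation.ReflTransGen (fun x y : S => x ≤ y ∨ y ≤ x) a ⟨p, h⟩}
  nonempty := ⟨a, a.2, .refl⟩
  convex := by
    rintro p ⟨hp, hap⟩ q ⟨hq, -⟩ z hpz hzq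
    exact ⟨hS p hp q hq z hpz hzq, hap.tail (Or.inl hpz)⟩
  connected := by
    intro p q
    let T : Set P :=
      {p | ∃ h : p ∈ S, Relation.ReflTransGen (fun x y : S => x ≤ y ∨ y ≤ x) a ⟨p, h⟩}
    have key : ∀ b : S, ∀ hb : Relation.ReflTransGen (fun x y : S => x ≤ y ∨ y ≤ x) a b,
        Relation.ReflTransGen (fun x y : T => x ≤ y ∨ y ≤ x) ⟨a, a.2, .refl⟩ ⟨b, b.2, hb⟩ := by
      intro b hb
      induction hb with
      | refl => exact .refl
      | tail _ hbc ih => exact ih.tail hbc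
    have symm : Std.Symm (fun x y : T => x ≤ y ∨ y ≤ x) := ⟨fun x y hxy => hxy.symm⟩
    obtain ⟨p, hp, hap⟩ := p
    obtain ⟨q, hq, haq⟩ := q
    exact (Std.Symm.symm _ _ (key ⟨p, hp⟩ hap)).trans (key ⟨q, hq⟩ haq)

lemma mem_componentOf (S : Set P) (hS : ∀ p ∈ S, ∀ q ∈ S, ∀ z, p ≤ z → z ≤ q → z ∈ S) (a : S) :
    a.1 ∈ (componentOf S hS a).carrier :=
  ⟨a.2, .refl⟩

lemma isComponent_componentOf (S : Set P) (hS : ∀ p ∈ S, ∀ q ∈ S, ∀ z, p ≤ z → z ≤ q → z ∈ S)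
    (a : S) : (componentOf S hS a).IsComponent S :=
  ⟨fun _ hp => hp.1, fun _ ⟨_, hap⟩ _ hq hpq => ⟨hq, hap.tail hpq⟩⟩

end Component

section Restriction

variable {k : Type u} [Field k] {P Q : Type*} [Preorder P] [Preorder Q]

/-- The restriction of a persistence module along an order-preserving map. -/
abbrev restrictAlong (f : P →o Q) (M : PersistenceModule k Q) : PersistenceModule k P :=
  ((Functor.whiskeringLeft _ _ _).obj f.monotone.functor).obj M

open Classical in
/-- The pullback of a family of vectors, cut off outside of `C`. -/
def cutVec (f : P →o Q) (M : PersistenceModule k Q) (C : Set P) (v : ∀ q, M.obj q) (p : P) :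
    (restrictAlong f M).obj p :=
  if p ∈ C then v (f p) else (0 : M.obj (f p))

open Classical in
/-- The pullback of a family of functionals, cut off outside of `C`. -/
def cutCoord (f : P →o Q) (M : PersistenceModule k Q) (C : Set P) (φ : ∀ q, M.obj q →ₗ[k] k)
    (p : P) : (restrictAlong f M).obj p →ₗ[k] k :=
  if p ∈ C then φ (f p) else (0 : M.obj (f p) →ₗ[k] k)

section Cut

variable (f : P →o Q) (M : PersistenceModule k Q) {C : Set P} (v : ∀ q, M.obj q)
  (φ : ∀ q, M.obj q →ₗ[k] k) {p : P}

lemma cutVec_of_mem (h : p ∈ C) : cutVec f M C v p = v (f p) := if_pos h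

lemma cutVec_of_notMem (h : p ∉ C) : cutVec f M C v p = 0 := if_neg h

lemma cutCoord_of_mem (h : p ∈ C) (x : (restrictAlong f M).obj p) :
    cutCoord f M C φ p x = φ (f p) x := by
  have : cutCoord f M C φ p = φ (f p) := if_pos h
  rw [this]
  rfl

lemma cutCoord_of_notMem (h : p ∉ C) : cutCoord f M C φ p = 0 := if_neg h

end Cut

/-- The interval basis of a restriction: every basis interval is replaced by the connected
components of its preimage. -/
def IntervalBasis.restrictAlong {M : PersistenceModule k Q} {ι : Type*} [Fintype ι]
    {J : ι → PosetInterval Q} (b : IntervalBasis M J) (f : P →o Q)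
    [Fintype (Σ x : ι, {C : PosetInterval P // C.IsComponent (f ⁻¹' (J x).carrier)})] :
    IntervalBasis (restrictAlong f M)
      fun x : (Σ x : ι, {C : PosetInterval P // C.IsComponent (f ⁻¹' (J x).carrier)}) => x.2.1 where
  vec x := cutVec f M x.2.1.carrier (b.vec x.1)
  coord x := cutCoord f M x.2.1.carrier (b.coord x.1)
  map_vec := by
    rintro ⟨x, C, hC⟩ p q h (hp : p ∈ C.carrier)
    dsimp only
    rw [cutVec_of_mem f M _ hp]
    refine (b.map_vec x (f p) (f q) (f.monotone h) (hC.1 hp)).trans ?_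
    by_cases hq : q ∈ C.carrier
    · exact (cutVec_of_mem f M _ hq).symm
    -- A step from `C` to a point outside `C` leaves the whole preimage, since `C` is a component;
    -- the vector is therefore already zero there.
    · rw [cutVec_of_notMem f M _ hq]
      exact b.vec_eq_zero x _ fun hq' => hq (hC.2 p hp q hq' (Or.inl h))
  vec_eq_zero x p hp := cutVec_of_notMem f M _ hp
  coord_map := by
    rintro ⟨x, C, hC⟩ p q h (hq : q ∈ C.carrier) v
    dsimp only
    rw [cutCoord_of_mem f M _ hq]
    refine (b.coord_map x (f p) (f q) (f.monotone h) (hC.1 hq) v).trans ?_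
    by_cases hp : p ∈ C.carrier
    · exact (cutCoord_of_mem f M _ hp v).symm
    · rw [cutCoord_of_notMem f M _ hp,
        b.coord_eq_zero x (f p) fun hp' => hp (hC.2 q hq p hp' (Or.inr h))]
      rfl
  coord_eq_zero x p hp := cutCoord_of_notMem f M _ hp
  coord_self := by
    rintro ⟨x, C, hC⟩ p (hp : p ∈ C.carrier)
    dsimp only
    rw [cutCoord_of_mem f M _ hp, cutVec_of_mem f M _ hp]
    exact b.coord_self x _ (hC.1 hp)
  coord_ne := by
    rintro ⟨x, C, hC⟩ ⟨y, D, hD⟩ p h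
    dsimp only
    by_cases hp : p ∈ C.carrier
    · by_cases hq : p ∈ D.carrier
      · rw [cutCoord_of_mem f M _ hp, cutVec_of_mem f M _ hq]
        refine b.coord_ne x y _ ?_
        rintro rfl
        obtain rfl := hC.eq_of_mem hD hp hq
        exact h rfl
      · rw [cutVec_of_notMem f M _ hq, map_zero]
    · rw [cutCoord_of_notMem f M _ hp, LinearMap.zero_apply]
  total p v := by
    have hfin : ∀ x, Finite {C : PosetInterval P // C.IsComponent (f ⁻¹' (J x).carrier)} :=
      fun x => Finite.of_injective (β := Σ x : ι, {C : PosetInterval P //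
        C.IsComponent (f ⁻¹' (J x).carrier)}) (fun C => ⟨x, C⟩)
        fun C D h => eq_of_heq (Sigma.mk.inj h).2
    have : ∀ x, Fintype {C : PosetInterval P // C.IsComponent (f ⁻¹' (J x).carrier)} :=
      fun x => Fintype.ofFinite _
    have key : ∀ x, ∑ C : {C : PosetInterval P // C.IsComponent (f ⁻¹' (J x).carrier)},
        cutCoord f M C.1.carrier (b.coord x) p v • cutVec f M C.1.carrier (b.vec x) p
          = b.coord x (f p) v • b.vec x (f p) := by
      intro x
      -- Distinct components are disjoint, so at `p` only the component containing `p` contributes.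
      by_cases hp : f p ∈ (J x).carrier
      · have hS : ∀ a ∈ f ⁻¹' (J x).carrier, ∀ c ∈ f ⁻¹' (J x).carrier, ∀ z, a ≤ z → z ≤ c →
            z ∈ f ⁻¹' (J x).carrier := fun a ha c hc z haz hzc =>
          (J x).convex _ ha _ hc _ (f.monotone haz) (f.monotone hzc)
        have hC := isComponent_componentOf _ hS ⟨p, hp⟩
        have hpC := mem_componentOf _ hS ⟨p, hp⟩
        rw [Finset.sum_eq_single ⟨componentOf _ hS ⟨p, hp⟩, hC⟩]
        · rw [cutCoord_of_mem f M _ hpC, cutVec_of_mem f M _ hpC]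
          rfl
        · rintro ⟨D, hD⟩ _ hne
          have hpD : p ∉ D.carrier := fun hpD => hne (Subtype.ext (hD.eq_of_mem hC hpD hpC))
          rw [cutVec_of_notMem f M _ hpD, smul_zero]
        · exact fun h => absurd (Finset.mem_univ _) h
      · rw [b.vec_eq_zero x _ hp, smul_zero]
        refine Finset.sum_eq_zero fun C _ => ?_
        rw [cutVec_of_notMem f M _ fun hpC => hp (C.2.1 hpC), smul_zero]
    have hsum := Fintype.sum_sigma fun x : (Σ x : ι, {C : PosetInterval P //
        C.IsComponent (f ⁻¹' (J x).carrier)}) => cutCoord f M x.2.1.carrier (b.coord x.1) p v •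
          cutVec f M x.2.1.carrier (b.vec x.1) p
    refine Eq.trans (by convert! hsum) ((Finset.sum_congr rfl fun x _ => key x).trans ?_)
    exact b.total (f p) v

/-- The multiplicity of a common component of the preimages of the intervals of one type. -/
lemma IntervalBasis.barcode_restrictAlong [Finite P] [Finite Q] {M : PersistenceModule k Q}
    {ι : Type*} [Fintype ι] {J : ι → PosetInterval Q} (b : IntervalBasis M J) (f : P →o Q)
    {μ : PosetInterval Q → ℕ} {ν : PosetInterval P → ℕ} (hμ : IsBarcode M μ)
    (hν : IsBarcode (_root_.restrictAlong f M) ν) {I : PosetInterval Q} {C : PosetInterval P}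
    (h : ∀ I', C.IsComponent (f ⁻¹' I'.carrier) ↔ I' = I) : μ I = ν C := by
  classical
  have := Fintype.ofFinite
    (Σ x : ι, {C : PosetInterval P // C.IsComponent (f ⁻¹' (J x).carrier)})
  rw [b.card_eq_of_isBarcode hμ, (b.restrictAlong f).card_eq_of_isBarcode hν]
  -- By `h`, an index `x` has `C` among its components exactly when `J x = I`, and then in exactly
  -- one way.
  refine Fintype.card_congr
    { toFun := fun x => ⟨⟨x.1, C, (h _).2 x.2⟩, rfl⟩
      invFun := fun x => ⟨x.1.1, (h _).1
        (Eq.subst (motive := fun D : PosetInterval P => D.IsComponent _) x.2 x.1.2.2)⟩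
      left_inv := fun x => rfl
      right_inv := ?_ }
  rintro ⟨⟨x, D, hD⟩, rfl⟩
  rfl

end Restriction

/-! ### Splitting off interval summands -/

section IntervalSummand

variable {k : Type u} [Field k] {P : Type v} [Preorder P]

/-- An interval summand of `M`: maps `k I ⟶ M ⟶ k I` whose composite is the identity. -/
structure IntervalSummand (M : PersistenceModule k P) (I : PosetInterval P) where
  vec : ∀ p, M.obj p
  coord : ∀ p, M.obj p →ₗ[k] k
  map_vec : ∀ p q (h : p ≤ q), p ∈ I.carrier → M.linearMap h (vec p) = vec q
  vec_eq_zero : ∀ p, p ∉ I.carrier → vec p = 0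
  coord_map : ∀ p q (h : p ≤ q), q ∈ I.carrier → ∀ v, coord q (M.linearMap h v) = coord p v
  coord_eq_zero : ∀ p, p ∉ I.carrier → coord p = 0
  coord_vec_of_exists : ∃ p ∈ I.carrier, coord p (vec p) = 1

namespace IntervalSummand

variable {M : PersistenceModule k P} {I : PosetInterval P} (s : IntervalSummand M I)

/-- The scalar is constant along comparable points of `I`, and `I` is connected; normalisation at
one point is thus enough. -/
lemma coord_vec {p : P} (hp : p ∈ I.carrier) : s.coord p (s.vec p) = 1 := by
  obtain ⟨a, ha, h⟩ := s.coord_vec_of_exists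
  refine I.subset_of_closed {p | s.coord p (s.vec p) = 1} ha h ?_ hp
  rintro b hb c hc (hbS : s.coord b (s.vec b) = 1) (hbc | hbc)
  · change s.coord c (s.vec c) = 1
    rw [← s.map_vec b c hbc hb, s.coord_map b c hbc hc, hbS]
  · change s.coord c (s.vec c) = 1
    rw [← s.coord_map c b hbc hb, s.map_vec c b hbc hc, hbS]

/-- This makes the kernels of the functionals a submodule of `M`, which serves as the complement of
the summand. -/
lemma coord_linearMap_of_coord_eq_zero {p q : P} (h : p ≤ q) {v : M.obj p}
    (hv : s.coord p v = 0) : s.coord q (M.linearMap h v) = 0 := by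
  by_cases hq : q ∈ I.carrier
  · rw [s.coord_map p q h hq, hv]
  · rw [s.coord_eq_zero q hq, LinearMap.zero_apply]

/-- The complement of an interval summand. -/
def compl : PersistenceModule k P where
  obj p := FGModuleCat.of k (LinearMap.ker (s.coord p))
  map {p q} f := FGModuleCat.ofHom ((M.linearMap (leOfHom f)).restrict
    fun _ hv => s.coord_linearMap_of_coord_eq_zero _ hv)
  map_id p := by
    apply FGModuleCat.hom_ext
    ext x
    exact linearMap_self M le_rfl x.1
  map_comp f g := by
    apply FGModuleCat.hom_ext
    ext x
    exact (linearMap_linearMap M (leOfHom f) (leOfHom g) x.1).symm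

/-- The inclusion of the complement. -/
def complIncl (p : P) : s.compl.obj p →ₗ[k] M.obj p :=
  (LinearMap.ker (s.coord p)).subtype

lemma complIncl_injective (p : P) : Function.Injective (s.complIncl p) :=
  Subtype.val_injective

lemma complIncl_linearMap {p q : P} (h : p ≤ q) (x : s.compl.obj p) :
    s.complIncl q (s.compl.linearMap h x) = M.linearMap h (s.complIncl p x) :=
  rfl

lemma coord_complIncl (p : P) (x : s.compl.obj p) : s.coord p (s.complIncl p x) = 0 :=
  Subtype.property (p := (· ∈ LinearMap.ker (s.coord p))) x

/-- The projection onto the complement. -/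
def complProj (p : P) : M.obj p →ₗ[k] s.compl.obj p :=
  LinearMap.codRestrict (LinearMap.ker (s.coord p))
    (LinearMap.id - (s.coord p).smulRight (s.vec p)) fun v => by
      by_cases hp : p ∈ I.carrier
      · simp [s.coord_vec hp]
      · simp [s.coord_eq_zero p hp]

lemma complIncl_complProj (p : P) (v : M.obj p) :
    s.complIncl p (s.complProj p v) = v - s.coord p v • s.vec p :=
  rfl

lemma complProj_complIncl (p : P) (x : s.compl.obj p) : s.complProj p (s.complIncl p x) = x := by
  apply s.complIncl_injective
  rw [complIncl_complProj, coord_complIncl, zero_smul, sub_zero]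

lemma complProj_vec (p : P) : s.complProj p (s.vec p) = 0 := by
  apply s.complIncl_injective
  rw [complIncl_complProj, map_zero]
  by_cases hp : p ∈ I.carrier
  · rw [s.coord_vec hp, one_smul, sub_self]
  · rw [s.vec_eq_zero p hp, smul_zero, sub_zero]

lemma complProj_linearMap {p q : P} (h : p ≤ q) (v : M.obj p) :
    s.complProj q (M.linearMap h v) = s.compl.linearMap h (s.complProj p v) := by
  apply s.complIncl_injective
  rw [complIncl_complProj, complIncl_linearMap, complIncl_complProj, map_sub, map_smul]
  by_cases hp : p ∈ I.carrier
  · rw [s.map_vec p q h hp]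
    by_cases hq : q ∈ I.carrier
    · rw [s.coord_map p q h hq]
    · rw [s.vec_eq_zero q hq, smul_zero, smul_zero]
  · rw [s.vec_eq_zero p hp, map_zero, smul_zero]
    by_cases hq : q ∈ I.carrier
    · rw [s.coord_map p q h hq, s.coord_eq_zero p hp, LinearMap.zero_apply, zero_smul]
    · rw [s.vec_eq_zero q hq, smul_zero]

lemma finrank_compl_le (p : P) :
    Module.finrank k (s.compl.obj p) ≤ Module.finrank k (M.obj p) :=
  LinearMap.finrank_le_finrank_of_injective (s.complIncl_injective p)

lemma finrank_compl_lt {p : P} (hp : p ∈ I.carrier) :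
    Module.finrank k (s.compl.obj p) < Module.finrank k (M.obj p) := by
  refine Submodule.finrank_lt (s := LinearMap.ker (s.coord p)) fun h => ?_
  have h1 : s.vec p ∈ LinearMap.ker (s.coord p) := h ▸ Submodule.mem_top
  rw [LinearMap.mem_ker, s.coord_vec hp] at h1
  exact one_ne_zero h1

/-- An interval basis of the complement extended by the interval summand. -/
def extend {ι : Type*} [Fintype ι] {J : ι → PosetInterval P} (b : IntervalBasis s.compl J) :
    IntervalBasis M fun o : Option ι => o.elim I J where
  vec o p := o.elim (s.vec p) fun x => s.complIncl p (b.vec x p)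
  coord o p := o.elim (s.coord p) fun x => b.coord x p ∘ₗ s.complProj p
  map_vec := by
    rintro (_ | x) p q h hp
    · exact s.map_vec p q h hp
    · change M.linearMap h (s.complIncl p (b.vec x p)) = s.complIncl q (b.vec x q)
      rw [← complIncl_linearMap, b.map_vec x p q h hp]
  vec_eq_zero := by
    rintro (_ | x) p hp
    · exact s.vec_eq_zero p hp
    · change s.complIncl p (b.vec x p) = 0
      rw [b.vec_eq_zero x p hp, map_zero]
  coord_map := by
    rintro (_ | x) p q h hq v
    · exact s.coord_map p q h hq v
    · change b.coord x q (s.complProj q (M.linearMap h v)) = b.coord x p (s.complProj p v)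
      rw [complProj_linearMap, b.coord_map x p q h hq]
  coord_eq_zero := by
    rintro (_ | x) p hp
    · exact s.coord_eq_zero p hp
    · change b.coord x p ∘ₗ s.complProj p = 0
      rw [b.coord_eq_zero x p hp, LinearMap.zero_comp]
  coord_self := by
    rintro (_ | x) p hp
    · exact s.coord_vec hp
    · change b.coord x p (s.complProj p (s.complIncl p (b.vec x p))) = 1
      rw [complProj_complIncl, b.coord_self x p hp]
  coord_ne := by
    rintro (_ | x) (_ | y) p h
    · exact absurd rfl h
    · exact s.coord_complIncl p _
    · change b.coord x p (s.complProj p (s.vec p)) = 0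
      rw [complProj_vec, map_zero]
    · change b.coord x p (s.complProj p (s.complIncl p (b.vec y p))) = 0
      rw [complProj_complIncl, b.coord_ne x y p fun h' => h (congrArg some h')]
  total p v := by
    rw [Fintype.sum_option]
    change s.coord p v • s.vec p
      + ∑ x, b.coord x p (s.complProj p v) • s.complIncl p (b.vec x p) = v
    have h := congrArg (s.complIncl p) (b.total p (s.complProj p v))
    rw [map_sum, complIncl_complProj] at h
    simp only [map_smul] at h
    rw [h, add_sub_cancel]

end IntervalSummand

/-- If every nonzero persistence module has an interval summand, then every persistence module
has an interval basis. -/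
lemma exists_intervalBasis [Finite P] (A : PosetInterval P → Prop)
    (h : ∀ M : PersistenceModule k P, (∃ p, Nontrivial (M.obj p)) →
      ∃ I, A I ∧ Nonempty (IntervalSummand M I)) (M : PersistenceModule k P) :
    ∃ (ι : Type) (_ : Fintype ι) (J : ι → PosetInterval P),
      (∀ x, A (J x)) ∧ Nonempty (IntervalBasis M J) := by
  have := Fintype.ofFinite P
  -- The complement has smaller total dimension, since its dimension drops at every point of the
  -- nonempty interval `I`.
  induction hd : ∑ p, Module.finrank k (M.obj p) using Nat.strong_induction_on generalizing M with
  | _ d ih =>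
    by_cases hM : ∃ p, Nontrivial (M.obj p)
    · obtain ⟨I, hI, ⟨s⟩⟩ := h M hM
      obtain ⟨p, hp⟩ := I.nonempty
      have hlt : ∑ p, Module.finrank k (s.compl.obj p) < d := by
        rw [← hd]
        exact Finset.sum_lt_sum (fun p _ => s.finrank_compl_le p)
          ⟨p, Finset.mem_univ p, s.finrank_compl_lt hp⟩
      obtain ⟨ι, _, J, hJ, ⟨b⟩⟩ := ih _ hlt s.compl rfl
      refine ⟨Option ι, inferInstance, _, ?_, ⟨s.extend b⟩⟩
      rintro (_ | x)
      · exact hI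
      · exact hJ x
    · have hsub : ∀ p, Subsingleton (M.obj p) := fun p =>
        not_nontrivial_iff_subsingleton.1 fun hp => hM ⟨p, hp⟩
      refine ⟨Empty, inferInstance, fun x => x.elim, fun x => x.elim, ⟨?_⟩⟩
      exact
        { vec := fun x => x.elim
          coord := fun x => x.elim
          map_vec := fun x => x.elim
          vec_eq_zero := fun x => x.elim
          coord_map := fun x => x.elim
          coord_eq_zero := fun x => x.elim
          coord_self := fun x => x.elim
          coord_ne := fun x => x.elim
          total := fun p v => Subsingleton.elim _ _ }

end IntervalSummand

/-! ### Interval summands of modules over the bipath poset -/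

section Flags

variable {k V W : Type*} [Field k] [AddCommGroup V] [Module k V] [AddCommGroup W] [Module k W]

/-- Take the least index at which `A` is nonzero, and the least index at which `B` meets that
subspace. Then `A i = ⊥` and `A (i + 1) ⊓ B j = ⊥`, so any nonzero `x` in `A (i + 1) ⊓ B (j + 1)`
works. No monotonicity of the families is involved. -/
lemma exists_mem_inf_notMem_sup_of_flags [Nontrivial V] (A B : ℕ → Submodule k V) (n m : ℕ)
    (hA : A 0 = ⊥) (hA' : A n = ⊤) (hB : B 0 = ⊥) (hB' : B m = ⊤) :
    ∃ i < n, ∃ j < m, ∃ x, x ∈ A (i + 1) ∧ x ∈ B (j + 1) ∧ x ∉ A i ⊔ B j := by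
  classical
  have h1 : ∃ i, A i ≠ ⊥ := ⟨n, hA' ▸ top_ne_bot⟩
  obtain ⟨i, hi⟩ := Nat.exists_eq_succ_of_ne_zero (n := Nat.find h1)
    fun h => Nat.find_spec h1 (by rw [h, hA])
  have hi1 : A (i + 1) ≠ ⊥ := by
    rw [← Nat.succ_eq_add_one, ← hi]
    exact Nat.find_spec h1
  have hi0 : A i = ⊥ := by
    by_contra h
    have := Nat.find_min' h1 h
    omega
  have hin : Nat.find h1 ≤ n := Nat.find_min' h1 (hA' ▸ top_ne_bot)
  have h2 : ∃ j, A (i + 1) ⊓ B j ≠ ⊥ := ⟨m, by rwa [hB', inf_top_eq]⟩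
  obtain ⟨j, hj⟩ := Nat.exists_eq_succ_of_ne_zero (n := Nat.find h2)
    fun h => Nat.find_spec h2 (by rw [h, hB, inf_bot_eq])
  have hj1 : A (i + 1) ⊓ B (j + 1) ≠ ⊥ := by
    rw [← Nat.succ_eq_add_one j, ← hj]
    exact Nat.find_spec h2
  have hj0 : A (i + 1) ⊓ B j = ⊥ := by
    by_contra h
    have := Nat.find_min' h2 h
    omega
  have hjm : Nat.find h2 ≤ m := Nat.find_min' h2 (by rwa [hB', inf_top_eq])
  obtain ⟨x, hx, hx0⟩ := Submodule.exists_mem_ne_zero_of_ne_bot hj1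
  refine ⟨i, by omega, j, by omega, x, hx.1, hx.2, fun h => hx0 ?_⟩
  rw [hi0, bot_sup_eq] at h
  exact (Submodule.mem_bot k).1 (hj0 ▸ ⟨hx.1, h⟩)

lemma exists_functional_eq_one (S : Submodule k V) {x : V} (hx : x ∉ S) :
    ∃ ψ : V →ₗ[k] k, ψ x = 1 ∧ ∀ y ∈ S, ψ y = 0 := by
  obtain ⟨f, hf, h⟩ := Submodule.exists_dual_map_eq_bot_of_notMem hx inferInstance
  refine ⟨(f x)⁻¹ • f, by simp [hf], fun y hy => ?_⟩
  have : f y ∈ S.map f := Submodule.mem_map_of_mem hy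
  rw [h, Submodule.mem_bot] at this
  simp [this]

/-- Used to push a functional on the space at `0` forward to the ends of the two arms of a left
interval. -/
lemma exists_comp_eq_of_ker_le (f : V →ₗ[k] W) (ψ : V →ₗ[k] k)
    (h : ∀ x, f x = 0 → ψ x = 0) : ∃ θ : W →ₗ[k] k, ∀ x, θ (f x) = ψ x := by
  have : ψ ∈ LinearMap.range f.dualMap := by
    rw [LinearMap.range_dualMap_eq_dualAnnihilator_ker, Submodule.mem_dualAnnihilator]
    exact fun x hx => h x hx
  obtain ⟨θ, rfl⟩ := this
  exact ⟨θ, fun _ => rfl⟩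

end Flags

/-! ### Interval summands built from a vector and a functional. -/

section Constructions

variable {k : Type u} [Field k] {P : Type v} [Preorder P] {M : PersistenceModule k P}
  {I : PosetInterval P}

/-- A nonzero composite from the least to the greatest element gives a full interval summand. -/
lemma nonempty_intervalSummand_of_univ {o t : P} (ho : ∀ p, o ≤ p) (ht : ∀ p, p ≤ t)
    (hI : ∀ p, p ∈ I.carrier) {x : M.obj o} (hx : M.linearMap (ho t) x ≠ 0) :
    Nonempty (IntervalSummand M I) := by
  obtain ⟨ψ, hψ, -⟩ := exists_functional_eq_one (⊥ : Submodule k (M.obj t)) (by simpa using hx)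
  exact ⟨
    { vec := fun p => M.linearMap (ho p) x
      coord := fun p => ψ ∘ₗ M.linearMap (ht p)
      map_vec := fun p q h _ => linearMap_linearMap M _ _ x
      vec_eq_zero := fun p hp => absurd (hI p) hp
      coord_map := fun p q h _ v => congrArg ψ (linearMap_linearMap M _ _ v)
      coord_eq_zero := fun p hp => absurd (hI p) hp
      coord_vec_of_exists :=
        ⟨o, hI o, (congrArg ψ (linearMap_linearMap M _ _ x)).trans hψ⟩ }⟩

open Classical in
/-- A summand supported on the points below `a` or `b`, where only `o` is below both. -/
lemma nonempty_intervalSummand_of_le_or_le {o a b : P} (ho : ∀ p, o ≤ p)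
    (hI : ∀ p, p ∈ I.carrier ↔ p ≤ a ∨ p ≤ b) (hab : ∀ p, p ≤ a → p ≤ b → p = o)
    {x : M.obj o} (hx : ∀ p, p ∉ I.carrier → M.linearMap (ho p) x = 0) {ψ : M.obj o →ₗ[k] k}
    (hψx : ψ x = 1) (hψa : ∀ y, M.linearMap (ho a) y = 0 → ψ y = 0)
    (hψb : ∀ y, M.linearMap (ho b) y = 0 → ψ y = 0) : Nonempty (IntervalSummand M I) := by
  obtain ⟨α, hα⟩ := exists_comp_eq_of_ker_le _ ψ hψa
  obtain ⟨β, hβ⟩ := exists_comp_eq_of_ker_le _ ψ hψb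
  let φ : ∀ p, M.obj p →ₗ[k] k := fun p =>
    if h : p ≤ a then α ∘ₗ M.linearMap h else if h : p ≤ b then β ∘ₗ M.linearMap h else 0
  have hφa : ∀ p (h : p ≤ a) v, φ p v = α (M.linearMap h v) := fun p h v => by
    simp only [φ, dif_pos h]
    rfl
  have hφb : ∀ p (h : p ≤ b) v, φ p v = β (M.linearMap h v) := fun p h v => by
    by_cases h' : p ≤ a
    -- The two formulas overlap only at `o`, where both give `ψ`.
    · obtain rfl := hab p h' h
      rw [hφa _ h', hα, hβ]
    · simp only [φ, dif_neg h', dif_pos h]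
      rfl
  exact ⟨
    { vec := fun p => M.linearMap (ho p) x
      coord := φ
      map_vec := fun p q h _ => linearMap_linearMap M _ _ x
      vec_eq_zero := hx
      coord_map := fun p q h hq v => by
        rcases (hI q).1 hq with hq | hq
        · rw [hφa q hq, hφa p (h.trans hq), linearMap_linearMap]
        · rw [hφb q hq, hφb p (h.trans hq), linearMap_linearMap]
      coord_eq_zero := fun p hp => by
        rw [hI, not_or] at hp
        simp only [φ, dif_neg hp.1, dif_neg hp.2]
      coord_vec_of_exists :=
        ⟨o, (hI o).2 (Or.inl (ho a)), by rw [hφa o (ho a), linearMap_self, hα, hψx]⟩ }⟩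

open Classical in
/-- A summand supported on the points above `a` or `b`, where only `t` is above both. -/
lemma nonempty_intervalSummand_of_ge_or_ge {t a b : P} (ht : ∀ p, p ≤ t)
    (hI : ∀ p, p ∈ I.carrier ↔ a ≤ p ∨ b ≤ p) (hab : ∀ p, a ≤ p → b ≤ p → p = t)
    {ψ : M.obj t →ₗ[k] k} (hψ : ∀ p, p ∉ I.carrier → ∀ v, ψ (M.linearMap (ht p) v) = 0)
    {x : M.obj a} {y : M.obj b} (hxy : M.linearMap (ht a) x = M.linearMap (ht b) y)
    (hψx : ψ (M.linearMap (ht a) x) = 1) : Nonempty (IntervalSummand M I) := by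
  let w : ∀ p, M.obj p := fun p =>
    if h : a ≤ p then M.linearMap h x else if h : b ≤ p then M.linearMap h y else 0
  have hwa : ∀ p (h : a ≤ p), w p = M.linearMap h x := fun p h => by
    simp only [w, dif_pos h]
  have hwb : ∀ p (h : b ≤ p), w p = M.linearMap h y := fun p h => by
    by_cases h' : a ≤ p
    -- The two formulas overlap only at `t`, where they agree by `hxy`.
    · obtain rfl := hab p h' h
      rw [hwa _ h', hxy]
    · simp only [w, dif_neg h', dif_pos h]
  exact ⟨
    { vec := w
      coord := fun p => ψ ∘ₗ M.linearMap (ht p)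
      map_vec := fun p q h hp => by
        rcases (hI p).1 hp with hp | hp
        · rw [hwa p hp, hwa q (hp.trans h), linearMap_linearMap]
        · rw [hwb p hp, hwb q (hp.trans h), linearMap_linearMap]
      vec_eq_zero := fun p hp => by
        rw [hI, not_or] at hp
        simp only [w, dif_neg hp.1, dif_neg hp.2]
      coord_map := fun p q h _ v => congrArg ψ (linearMap_linearMap M _ _ v)
      coord_eq_zero := fun p hp => LinearMap.ext fun v => hψ p hp v
      coord_vec_of_exists :=
        ⟨a, (hI a).2 (Or.inl le_rfl), by rwa [hwa a le_rfl, linearMap_self]⟩ }⟩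

open Classical in
/-- A summand supported on `Set.Icc a b`. -/
lemma nonempty_intervalSummand_of_Icc {a b : P} (hab : a ≤ b)
    (hI : ∀ p, p ∈ I.carrier ↔ a ≤ p ∧ p ≤ b) {x : M.obj a} (hx : M.linearMap hab x ≠ 0)
    (hx0 : ∀ q (h : a ≤ q), ¬ q ≤ b → M.linearMap h x = 0)
    (hM : ∀ p, p ≤ b → ¬ a ≤ p → Subsingleton (M.obj p)) : Nonempty (IntervalSummand M I) := by
  obtain ⟨ψ, hψ, -⟩ := exists_functional_eq_one (⊥ : Submodule k (M.obj b)) (by simpa using hx)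
  let w : ∀ p, M.obj p := fun p => if h : a ≤ p then M.linearMap h x else 0
  let φ : ∀ p, M.obj p →ₗ[k] k := fun p =>
    if h : a ≤ p ∧ p ≤ b then ψ ∘ₗ M.linearMap h.2 else 0
  have hw : ∀ p (h : a ≤ p), w p = M.linearMap h x := fun p h => by
    simp only [w, dif_pos h]
  have hφ : ∀ p (_ : a ≤ p) (h : p ≤ b) v, φ p v = ψ (M.linearMap h v) := fun p h h' v => by
    simp only [φ, dif_pos (And.intro h h')]
    rfl
  exact ⟨
    { vec := w
      coord := φ
      map_vec := fun p q h hp => by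
        rw [hw p ((hI p).1 hp).1, hw q (((hI p).1 hp).1.trans h), linearMap_linearMap]
      vec_eq_zero := fun p hp => by
        by_cases h : a ≤ p
        · rw [hw p h]
          exact hx0 p h fun h' => hp ((hI p).2 ⟨h, h'⟩)
        · simp only [w, dif_neg h]
      coord_map := fun p q h hq v => by
        have hq' := (hI q).1 hq
        rw [hφ q hq'.1 hq'.2, linearMap_linearMap]
        by_cases hp : a ≤ p
        · rw [hφ p hp (h.trans hq'.2)]
        -- Such a `p` lies below `b` but not above `a`, so its space is zero and compatibility is
        -- automatic.
        · have := hM p (h.trans hq'.2) hp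
          rw [Subsingleton.elim v 0, map_zero, map_zero, map_zero]
      coord_eq_zero := fun p hp => by
        rw [hI] at hp
        simp only [φ, dif_neg hp]
      coord_vec_of_exists := ⟨a, (hI a).2 ⟨le_rfl, hab⟩, by
        rw [hφ a le_rfl hab, hw a le_rfl, linearMap_linearMap, hψ]⟩ }⟩

end Constructions

/-! ### Decomposition of modules over the bipath poset, and classification of its intervals. -/

section BipathModules

variable {k : Type u} [Field k] {n m : ℕ} [hn : Fact (1 < n)]

lemma zero_val : (Bipath.zero n m).val = 0 := rfl

lemma mem_leftInterval {i j : Bipath n m} (hi hj) (z : Bipath n m) :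
    z ∈ (leftInterval i j hi hj).carrier ↔ z ≤ i ∨ z ≤ j := by
  have := Bipath.zero_le z
  simp [leftInterval, PosetInterval.ofHub, this]

lemma mem_topInterval {i j : Bipath n m} (hi hij hj) (z : Bipath n m) :
    z ∈ (topInterval i j hi hij hj).carrier ↔ i ≤ z ∧ z ≤ j :=
  Iff.rfl

lemma mem_bottomInterval {i j : Bipath n m} (hi hij) (z : Bipath n m) :
    z ∈ (bottomInterval i j hi hij).carrier ↔ j ≤ z ∧ z ≤ i :=
  Iff.rfl

variable [hm : Fact (1 < m)]

/-- The intervals of the bipath poset given by explicit formulas. -/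
def IsBipathInterval (I : PosetInterval (Bipath n m)) : Prop :=
  I = fullInterval n m ∨
  (∃ i j hi hj, I = leftInterval i j hi hj) ∨
  (∃ i j hi hj, I = rightInterval i j hi hj) ∨
  (∃ i j hi hij hj, I = topInterval i j hi hij hj) ∨
  (∃ i j hi hij, I = bottomInterval i j hi hij)

lemma mem_rightInterval {i j : Bipath n m} (hi hj) (z : Bipath n m) :
    z ∈ (rightInterval i j hi hj).carrier ↔ i ≤ z ∨ j ≤ z := by
  have := Bipath.le_last z
  simp [rightInterval, PosetInterval.ofHub, this]

/-- The `i`-th point of the top chain. -/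
def topPoint (n m : ℕ) [hm : Fact (1 < m)] (i : ℕ) : Bipath n m :=
  -- The truncation only keeps the definition total; all uses have `i ≤ n`.
  ⟨min i n, by have := hm.out; omega⟩

/-- The `j`-th point of the bottom chain. -/
def bottomPoint (n m : ℕ) [hm : Fact (1 < m)] (j : ℕ) : Bipath n m :=
  -- Both chains are numbered upwards from `0`, so `j = m` gives the greatest element `n`. Indices
  -- beyond `m` do not occur.
  ⟨if j = 0 then 0 else n + m - j, by have := hm.out; split_ifs <;> omega⟩

lemma topPoint_val (n m : ℕ) [Fact (1 < m)] {i : ℕ} (h : i ≤ n) : (topPoint n m i).val = i :=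
  min_eq_left h

lemma bottomPoint_val (n m : ℕ) [Fact (1 < m)] (j : ℕ) :
    (bottomPoint n m j).val = if j = 0 then 0 else n + m - j := rfl

lemma last_val (n m : ℕ) [Fact (1 < m)] : (Bipath.last n m).val = n := rfl

lemma linearMap_eq_zero_of_le {P : Type*} [Preorder P] (M : PersistenceModule k P) {p q r : P}
    (h : p ≤ q) (h' : q ≤ r) {x : M.obj p} (hx : M.linearMap h x = 0) :
    M.linearMap (h.trans h') x = 0 := by
  rw [← linearMap_linearMap M h h', hx, map_zero]

lemma eq_zero_of_linearMap_eq_zero {P : Type*} [Preorder P] (M : PersistenceModule k P) {p q : P}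
    (h : p ≤ q) (h' : q ≤ p) {x : M.obj p} (hx : M.linearMap h x = 0) : x = 0 := by
  rw [← linearMap_self M le_rfl x, ← linearMap_linearMap M h h', hx, map_zero]

lemma exists_linearMap_eq {P : Type*} [Preorder P] (M : PersistenceModule k P) {p q : P}
    (h : p ≤ q) (h' : q ≤ p) (y : M.obj q) : ∃ x, M.linearMap h x = y :=
  ⟨M.linearMap h' y, by rw [linearMap_linearMap, linearMap_self]⟩

/-- The kernels of the maps out of `0` form one flag along each chain; both begin at zero and, by
`h`, end with the whole space. The vector `x` dies exactly at `i + 1` on the top chain and at `j +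
1` on the bottom chain. A functional that is `1` on `x` and kills `A i ⊔ B j` factors through the
spaces at the ends of both arms. The index `j = 0` yields the intervals `[i, 0]_◁`. -/
lemma exists_leftInterval_summand (M : PersistenceModule k (Bipath n m))
    (h : ∀ x, M.linearMap (Bipath.zero_le (Bipath.last n m)) x = 0)
    [Nontrivial (M.obj (Bipath.zero n m))] :
    ∃ i j hi hj, Nonempty (IntervalSummand M (leftInterval i j hi hj)) := by
  have h1 := hn.out
  have h2 := hm.out
  obtain ⟨i, hi, j, hj, x, hxi, hxj, hx⟩ := exists_mem_inf_notMem_sup_of_flags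
    (fun i => LinearMap.ker (M.linearMap (Bipath.zero_le (topPoint n m i))))
    (fun j => LinearMap.ker (M.linearMap (Bipath.zero_le (bottomPoint n m j)))) n m
    ((Submodule.eq_bot_iff _).2 fun x hx => eq_zero_of_linearMap_eq_zero M _ (by
      rw [Bipath.le_def, topPoint_val n m (Nat.zero_le n)]; omega) hx)
    ((Submodule.eq_top_iff').2 fun x => linearMap_eq_zero_of_le M _ (by
      rw [Bipath.le_def, topPoint_val n m le_rfl, last_val]; omega) (h x))
    ((Submodule.eq_bot_iff _).2 fun x hx => eq_zero_of_linearMap_eq_zero M _ (by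
      rw [Bipath.le_def, bottomPoint_val]; simp) hx)
    ((Submodule.eq_top_iff').2 fun x => linearMap_eq_zero_of_le M _ (by
      rw [Bipath.le_def, bottomPoint_val, last_val]; split_ifs <;> omega) (h x))
  obtain ⟨ψ, hψx, hψ⟩ := exists_functional_eq_one _ hx
  refine ⟨topPoint n m i, bottomPoint n m j, by rw [topPoint_val n m hi.le]; omega,
    by rw [bottomPoint_val]; split_ifs <;> omega, ?_⟩
  refine nonempty_intervalSummand_of_le_or_le Bipath.zero_le (mem_leftInterval _ _) ?_ ?_ hψx
    (fun y hy => hψ y (Submodule.mem_sup_left hy)) (fun y hy => hψ y (Submodule.mem_sup_right hy))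
  · intro p hp hp'
    rw [Bipath.le_def, topPoint_val n m hi.le] at hp
    rw [Bipath.le_def, bottomPoint_val] at hp'
    ext
    rw [zero_val]
    split_ifs at hp' <;> omega
  · intro p hp
    rw [mem_leftInterval] at hp
    have : topPoint n m (i + 1) ≤ p ∨ bottomPoint n m (j + 1) ≤ p := by
      have := p.isLt
      have hi' : i + 1 ≤ n := hi
      simp only [Bipath.le_def, topPoint_val n m hi', topPoint_val n m hi.le, bottomPoint_val] at hp ⊢
      split_ifs at hp ⊢ <;> omega
    rcases this with hp | hp
    · exact linearMap_eq_zero_of_le M _ hp hxi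
    · exact linearMap_eq_zero_of_le M _ hp hxj

/-- Dual to the left case, with images in the space at `n` in place of kernels. The vector `y` lifts
to `i + 1` on the top chain and to `j + 1` on the bottom chain, and the functional kills everything
coming from `i` or from `j`. -/
lemma exists_rightInterval_summand (M : PersistenceModule k (Bipath n m))
    (h : ∀ x, M.linearMap (Bipath.zero_le (Bipath.last n m)) x = 0)
    [Nontrivial (M.obj (Bipath.last n m))] :
    ∃ i j hi hj, Nonempty (IntervalSummand M (rightInterval i j hi hj)) := by
  have h1 := hn.out
  have h2 := hm.out
  have h0 : ∀ p : Bipath n m, p ≤ Bipath.zero n m →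
      LinearMap.range (M.linearMap (Bipath.le_last p)) = ⊥ := by
    intro p hp
    rw [Submodule.eq_bot_iff]
    rintro _ ⟨x, rfl⟩
    rw [← linearMap_linearMap M hp (Bipath.le_last _), h]
  have h3 : ∀ p : Bipath n m, Bipath.last n m ≤ p →
      LinearMap.range (M.linearMap (Bipath.le_last p)) = ⊤ := by
    intro p hp
    rw [LinearMap.range_eq_top]
    exact exists_linearMap_eq M _ hp
  obtain ⟨i, hi, j, hj, y, ⟨x₁, hx₁⟩, ⟨x₂, hx₂⟩, hy⟩ := exists_mem_inf_notMem_sup_of_flags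
    (fun i => LinearMap.range (M.linearMap (Bipath.le_last (topPoint n m i))))
    (fun j => LinearMap.range (M.linearMap (Bipath.le_last (bottomPoint n m j)))) n m
    (h0 _ (by rw [Bipath.le_def, topPoint_val n m (Nat.zero_le n)]; omega))
    (h3 _ (by rw [Bipath.le_def, topPoint_val n m le_rfl, last_val]; omega))
    (h0 _ (by rw [Bipath.le_def, bottomPoint_val]; simp))
    (h3 _ (by rw [Bipath.le_def, bottomPoint_val, last_val]; split_ifs <;> omega))
  obtain ⟨ψ, hψy, hψ⟩ := exists_functional_eq_one _ hy
  have hi' : i + 1 ≤ n := hi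
  refine ⟨topPoint n m (i + 1), bottomPoint n m (j + 1), by rw [topPoint_val n m hi']; omega,
    by rw [bottomPoint_val, if_neg j.succ_ne_zero]; omega, ?_⟩
  refine nonempty_intervalSummand_of_ge_or_ge Bipath.le_last (mem_rightInterval _ _) ?_ (ψ := ψ) ?_
    (hx₁.trans hx₂.symm) (by rw [hx₁, hψy])
  · intro p hp hp'
    have := p.isLt
    rw [Bipath.le_def, topPoint_val n m hi'] at hp
    rw [Bipath.le_def, bottomPoint_val, if_neg j.succ_ne_zero] at hp'
    ext
    rw [last_val]
    omega
  · intro p hp v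
    rw [mem_rightInterval] at hp
    have : p ≤ topPoint n m i ∨ p ≤ bottomPoint n m j := by
      have := p.isLt
      simp only [Bipath.le_def, topPoint_val n m hi', topPoint_val n m hi.le, bottomPoint_val] at hp ⊢
      split_ifs at hp ⊢ <;> omega
    apply hψ
    rcases this with hp | hp
    · exact Submodule.mem_sup_left ⟨M.linearMap hp v, linearMap_linearMap M _ _ v⟩
    · exact Submodule.mem_sup_right ⟨M.linearMap hp v, linearMap_linearMap M _ _ v⟩

lemma exists_isBipathInterval_summand (M : PersistenceModule k (Bipath n m))
    (hM : ∃ p, Nontrivial (M.obj p)) :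
    ∃ I, IsBipathInterval I ∧ Nonempty (IntervalSummand M I) := by
  have h1 := hn.out
  have h2 := hm.out
  by_cases h : ∀ x, M.linearMap (Bipath.zero_le (Bipath.last n m)) x = 0
  swap
  · push Not at h
    obtain ⟨x, hx⟩ := h
    exact ⟨_, Or.inl rfl, nonempty_intervalSummand_of_univ Bipath.zero_le Bipath.le_last
      (fun p => Set.mem_univ p) hx⟩
  by_cases h0 : Nontrivial (M.obj (Bipath.zero n m))
  · obtain ⟨i, j, hi, hj, hs⟩ := exists_leftInterval_summand M h
    exact ⟨_, Or.inr (Or.inl ⟨i, j, hi, hj, rfl⟩), hs⟩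
  by_cases h3 : Nontrivial (M.obj (Bipath.last n m))
  · obtain ⟨i, j, hi, hj, hs⟩ := exists_rightInterval_summand M h
    exact ⟨_, Or.inr (Or.inr (Or.inl ⟨i, j, hi, hj, rfl⟩)), hs⟩
  -- The module now vanishes at `0` and `n`, so it lives on two chains with no relations between
  -- them. Let `x` be born at a minimal point `a` of the support and survive until `b`.
  obtain ⟨a, ha⟩ := (Set.toFinite {p | Nontrivial (M.obj p)}).exists_minimal hM
  have ha' : Nontrivial (M.obj a) := ha.1
  obtain ⟨x, hx⟩ := exists_ne (0 : M.obj a)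
  obtain ⟨b, hb⟩ := (Set.toFinite {q | ∃ h : a ≤ q, M.linearMap h x ≠ 0}).exists_maximal
    ⟨a, le_rfl, by rwa [linearMap_self]⟩
  obtain ⟨hab, hxb⟩ := hb.1
  have hval : ∀ p, Nontrivial (M.obj p) → p.val ≠ 0 ∧ p.val ≠ n := by
    refine fun p hp => ⟨fun hp0 => h0 ?_, fun hp0 => h3 ?_⟩
    · rwa [show Bipath.zero n m = p from Bipath.ext hp0.symm]
    · rwa [show Bipath.last n m = p from Bipath.ext hp0.symm]
  have hva := hval a ha'
  have hvb := hval b ⟨_, _, hxb⟩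
  have hx0 : ∀ q (h : a ≤ q), ¬ q ≤ b → M.linearMap h x = 0 := by
    intro q h hqb
    by_contra hq
    refine hqb (hb.2 ⟨h, hq⟩ ?_)
    have := hval q ⟨_, _, hq⟩
    rw [Bipath.le_def] at h hqb hab ⊢
    omega
  have hM0 : ∀ p, p ≤ b → ¬ a ≤ p → Subsingleton (M.obj p) := by
    intro p hpb hap
    by_contra hp
    rw [not_subsingleton_iff_nontrivial] at hp
    refine hap (ha.2 hp ?_)
    have := hval p hp
    rw [Bipath.le_def] at hap hpb hab ⊢
    omega
  have hab' := hab
  rw [Bipath.le_def] at hab'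
  by_cases han : a.val < n
  · exact ⟨topInterval a b (by omega) (by omega) (by omega),
      Or.inr (Or.inr (Or.inr (Or.inl ⟨a, b, _, _, _, rfl⟩))),
      nonempty_intervalSummand_of_Icc hab (mem_topInterval _ _ _) hxb hx0 hM0⟩
  · exact ⟨bottomInterval b a (by omega) (by omega),
      Or.inr (Or.inr (Or.inr (Or.inr ⟨b, a, _, _, rfl⟩))),
      nonempty_intervalSummand_of_Icc hab (mem_bottomInterval _ _) hxb hx0 hM0⟩

lemma exists_bipath_intervalBasis (M : PersistenceModule k (Bipath n m)) :
    ∃ (ι : Type) (_ : Fintype ι) (J : ι → PosetInterval (Bipath n m)),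
      (∀ x, IsBipathInterval (J x)) ∧ Nonempty (IntervalBasis M J) :=
  exists_intervalBasis _ exists_isBipathInterval_summand M

/-- An interval module has an interval basis with one element. -/
def intervalModuleBasis (k : Type u) [Field k] {P : Type*} [Preorder P] (I : PosetInterval P) :
    IntervalBasis (intervalModule k I) fun _ : Unit => I :=
  .ofTotal (fun _ => 𝟙 _) (fun _ => 𝟙 _) (fun _ => Category.comp_id _)
    (fun _ _ h => absurd rfl h) (by simp)

/-- The module `ℚ I` has a decomposition into listed intervals, and by uniqueness `I` occurs in it.
The choice of field is immaterial. -/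
lemma isBipathInterval (I : PosetInterval (Bipath n m)) : IsBipathInterval I := by
  classical
  obtain ⟨ι, _, J, hJ, ⟨b⟩⟩ := exists_bipath_intervalBasis (intervalModule ℚ I)
  have h := (intervalModuleBasis ℚ I).card_le b I
  have h1 : 0 < Fintype.card {_x : Unit // I = I} := Fintype.card_pos_iff.2 ⟨⟨(), rfl⟩⟩
  obtain ⟨⟨x, hx⟩⟩ := Fintype.card_pos_iff.1 (h1.trans_le h)
  exact hx ▸ hJ x

end BipathModules

/-! ### Coordinates on the slice, and the component criterion. -/

section SlicePoints

variable {n m : ℕ}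

/-- The point of the slice with coordinate sum `s`. -/
def slicePoint (n m : ℕ) (s : ℤ) (h : -2 * (m : ℤ) + 3 ≤ s) (h' : s ≤ 2 * n + 2 * m - 1) :
    Slice n m :=
  ⟨⟨(OrderDual.toDual ((s + 1) / 2), s / 2), by
    change (s + 1) / 2 = s / 2 ∨ (s + 1) / 2 = s / 2 + 1
    omega⟩, by
    change -(m : ℤ) + 1 < (s + 1) / 2 ∧ s / 2 < (n : ℤ) + m
    omega⟩

lemma slicePoint_fst (s : ℤ) (h h') : (slicePoint n m s h h').1.fst = (s + 1) / 2 := rfl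

lemma slicePoint_snd (s : ℤ) (h h') : (slicePoint n m s h h').1.snd = s / 2 := rfl

lemma slicePoint_sum (s : ℤ) (h h') :
    (slicePoint n m s h h').1.fst + (slicePoint n m s h h').1.snd = s := by
  rw [slicePoint_fst, slicePoint_snd]
  omega

lemma slice_bounds (p : Slice n m) :
    -2 * (m : ℤ) + 3 ≤ p.1.fst + p.1.snd ∧ p.1.fst + p.1.snd ≤ 2 * n + 2 * m - 1 := by
  have h1 := p.1.fst_eq
  have h2 : -(m : ℤ) + 1 < p.1.fst ∧ p.1.snd < (n : ℤ) + m := p.2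
  omega

lemma slicePoint_self (p : Slice n m) :
    slicePoint n m (p.1.fst + p.1.snd) (slice_bounds p).1 (slice_bounds p).2 = p := by
  have h1 := p.1.fst_eq
  refine Subtype.ext (ZigzagPoset.ext' ?_ ?_)
  · rw [slicePoint_fst]
    omega
  · rw [slicePoint_snd]
    omega

/-- The sum of the coordinates identifies the slice with an integer interval: even sums are points
`(a, a)`, odd sums are points `(b + 1, b)`. -/
lemma slice_card (n m : ℕ) : Nat.card (Slice n m) = 2 * n + 4 * m - 3 := by
  have e : Slice n m ≃ Finset.Icc (-2 * (m : ℤ) + 3) (2 * n + 2 * m - 1) :=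
    { toFun := fun p => ⟨p.1.fst + p.1.snd, Finset.mem_Icc.2 (slice_bounds p)⟩
      invFun := fun s => slicePoint n m s (Finset.mem_Icc.1 s.2).1 (Finset.mem_Icc.1 s.2).2
      left_inv := fun p => slicePoint_self p
      right_inv := fun s => Subtype.ext (slicePoint_sum s.1 _ _) }
  rw [Nat.card_congr e, Nat.card_eq_fintype_card, Fintype.card_coe, Int.card_Icc]
  omega

lemma mem_sliceCC {a b : ℤ} (h) (p : Slice n m) : p ∈ (sliceCC n m a b h).carrier ↔
    2 * a ≤ p.1.fst + p.1.snd ∧ p.1.fst + p.1.snd ≤ 2 * b := by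
  have := p.1.fst_eq
  change p.1.fst ≤ b ∧ a ≤ p.1.snd ↔ _
  omega

lemma mem_sliceCO {a b : ℤ} (h) (p : Slice n m) : p ∈ (sliceCO n m a b h).carrier ↔
    2 * a ≤ p.1.fst + p.1.snd ∧ p.1.fst + p.1.snd ≤ 2 * b - 1 := by
  have := p.1.fst_eq
  change a ≤ p.1.snd ∧ p.1.snd < b ↔ _
  omega

lemma mem_sliceOC {a b : ℤ} (h) (p : Slice n m) : p ∈ (sliceOC n m a b h).carrier ↔
    2 * a + 1 ≤ p.1.fst + p.1.snd ∧ p.1.fst + p.1.snd ≤ 2 * b := by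
  have := p.1.fst_eq
  change a < p.1.fst ∧ p.1.fst ≤ b ↔ _
  omega

lemma mem_sliceOO {a b : ℤ} (h) (p : Slice n m) : p ∈ (sliceOO n m a b h).carrier ↔
    2 * a + 1 ≤ p.1.fst + p.1.snd ∧ p.1.fst + p.1.snd ≤ 2 * b - 1 := by
  have := p.1.fst_eq
  change a < p.1.fst ∧ p.1.snd < b ↔ _
  omega

lemma slicePoint_le_or_le (s t : ℤ) (h : t = s + 1) (h₁ h₂ h₃ h₄) :
    slicePoint n m s h₁ h₂ ≤ slicePoint n m t h₃ h₄ ∨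
      slicePoint n m t h₃ h₄ ≤ slicePoint n m s h₁ h₂ := by
  change ((t + 1) / 2 ≤ (s + 1) / 2 ∧ s / 2 ≤ t / 2) ∨ ((s + 1) / 2 ≤ (t + 1) / 2 ∧ t / 2 ≤ s / 2)
  omega

/-- Comparable points of the slice have coordinate sums differing by at most one. -/
lemma sum_le_of_comparable {p q : Slice n m} (h : p ≤ q ∨ q ≤ p) :
    q.1.fst + q.1.snd ≤ p.1.fst + p.1.snd + 1 ∧ p.1.fst + p.1.snd ≤ q.1.fst + q.1.snd + 1 := by
  have h1 := p.1.fst_eq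
  have h2 := q.1.fst_eq
  have h3 : (q.1.fst ≤ p.1.fst ∧ p.1.snd ≤ q.1.snd) ∨ (p.1.fst ≤ q.1.fst ∧ q.1.snd ≤ p.1.snd) := h
  omega

variable [hn : Fact (1 < n)] [hm : Fact (1 < m)]

/-- The covering map on the slice. -/
lemma sliceCoveringMap_slicePoint (s : ℤ) (h h') :
    (s % 2 = 1 ∧ s < 0 ∧ ((sliceCoveringMap n m (slicePoint n m s h h')).val : ℤ) = n + m + s / 2) ∨
    (s % 2 = 1 ∧ 0 ≤ s ∧ s < 2 * n ∧
      ((sliceCoveringMap n m (slicePoint n m s h h')).val : ℤ) = s / 2) ∨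
    (s % 2 = 1 ∧ 2 * n < s ∧ s < 2 * n + 2 * m - 1 ∧
      ((sliceCoveringMap n m (slicePoint n m s h h')).val : ℤ) = s / 2 + 1) ∨
    (s = 2 * n + 2 * m - 1 ∧ ((sliceCoveringMap n m (slicePoint n m s h h')).val : ℤ) = 0) ∨
    (s % 2 = 0 ∧ s ≤ 0 ∧
      ((sliceCoveringMap n m (slicePoint n m s h h')).val : ℤ) = n + m - 1 + s / 2) ∨
    (s % 2 = 0 ∧ 0 < s ∧ ((sliceCoveringMap n m (slicePoint n m s h h')).val : ℤ) = s / 2) := by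
  have h1 := hn.out
  have h2 := hm.out
  have hv : (sliceCoveringMap n m (slicePoint n m s h h')).val =
      if (s + 1) / 2 = s / 2 + 1 then
        if s / 2 % ((n : ℤ) + m - 1) < n then (s / 2 % ((n : ℤ) + m - 1)).toNat
        else (s / 2 % ((n : ℤ) + m - 1)).toNat + 1
      else
        if s / 2 % ((n : ℤ) + m - 1) = 0 then n + m - 1
        else (s / 2 % ((n : ℤ) + m - 1)).toNat := rfl
  rw [hv]
  -- With `N = n + m - 1`, the number `s / 2` lies in `[-N, -1]`, in `[0, N - 1]`, or equals `N`;
  -- the quotient by `N` is `-1`, `0` or `1` accordingly.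
  rcases lt_or_ge s 0 with h0 | h0
  · have hr := emod_eq_of_eq (N := (n : ℤ) + m - 1) (k := -1) (r := s / 2 + (n + m - 1))
      (x := s / 2) (by ring) (by omega) (by omega)
    rw [hr]
    split_ifs <;> omega
  rcases lt_or_ge (s / 2) ((n : ℤ) + m - 1) with h3 | h3
  · rw [Int.emod_eq_of_lt (by omega) h3]
    split_ifs <;> omega
  · have hr := emod_eq_of_eq (N := (n : ℤ) + m - 1) (k := 1) (r := 0)
      (x := s / 2) (by omega) (by omega) (by omega)
    rw [hr]
    split_ifs <;> omega

/-- A criterion for a slice interval `C` to be a component of the preimage of `I`, and of no other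
interval. -/
lemma isComponent_preimage_iff {I : PosetInterval (Bipath n m)} {C : PosetInterval (Slice n m)}
    (s t : ℤ) (hs : -2 * (m : ℤ) + 3 ≤ s) (hst : s ≤ t) (ht : t ≤ 2 * n + 2 * m - 1)
    (hC : ∀ p, p ∈ C.carrier ↔ s ≤ p.1.fst + p.1.snd ∧ p.1.fst + p.1.snd ≤ t)
    (hmem : ∀ r h h', s ≤ r → r ≤ t → sliceCoveringMap n m (slicePoint n m r h h') ∈ I.carrier)
    (hleft : ∀ h h', sliceCoveringMap n m (slicePoint n m (s - 1) h h') ∉ I.carrier)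
    (hright : ∀ h h', sliceCoveringMap n m (slicePoint n m (t + 1) h h') ∉ I.carrier)
    (hsurj : ∀ z ∈ I.carrier, ∃ r h h', s ≤ r ∧ r ≤ t ∧
      sliceCoveringMap n m (slicePoint n m r h h') = z)
    (hbetween : ∀ w ∈ I.carrier, ∀ w', w' ∉ I.carrier → (w ≤ w' ∨ w' ≤ w) →
      ∃ w₁ ∈ I.carrier, ∃ r h h', (r = s - 1 ∨ r = t + 1) ∧
        ((w₁ ≤ sliceCoveringMap n m (slicePoint n m r h h') ∧
            sliceCoveringMap n m (slicePoint n m r h h') ≤ w') ∨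
          (w' ≤ sliceCoveringMap n m (slicePoint n m r h h') ∧
            sliceCoveringMap n m (slicePoint n m r h h') ≤ w₁)))
    (I' : PosetInterval (Bipath n m)) :
    C.IsComponent (sliceCoveringMap n m ⁻¹' I'.carrier) ↔ I' = I := by
  constructor
  · intro hI
    have hsub : I.carrier ⊆ I'.carrier := by
      intro z hz
      obtain ⟨r, h, h', hr, hr', rfl⟩ := hsurj z hz
      exact hI.1 ((hC _).2 (by rw [slicePoint_sum]; exact ⟨hr, hr'⟩))
    -- If `I` were smaller than `I'`, connectedness would give comparable points `w` in `I` and `w'`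
    -- in `I'` outside `I`. By `hbetween` and convexity, `I'` then contains the image of a neighbour
    -- of `C` in the fence, and that neighbour would belong to the component `C`.
    refine (PosetInterval.IsComponent.eq ⟨hsub, fun w hw w' hw' hww' => ?_⟩).symm
    · by_contra hw''
      obtain ⟨w₁, hw₁, r, h, h', hr, hb⟩ := hbetween w hw w' hw'' hww'
      have hwI' : w₁ ∈ I'.carrier := hsub hw₁
      have hrI' : sliceCoveringMap n m (slicePoint n m r h h') ∈ I'.carrier := by
        rcases hb with hb | hb
        · exact I'.convex _ hwI' _ hw' _ hb.1 hb.2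
        · exact I'.convex _ hw' _ hwI' _ hb.1 hb.2
      have hrC : slicePoint n m r h h' ∈ C.carrier := by
        rcases hr with rfl | rfl
        · refine hI.2 (slicePoint n m s hs (hst.trans ht)) ((hC _).2 ?_) _ hrI'
            (slicePoint_le_or_le _ _ (by ring) _ _ _ _).symm
          rw [slicePoint_sum]
          exact ⟨le_rfl, hst⟩
        · refine hI.2 (slicePoint n m t (hs.trans hst) ht) ((hC _).2 ?_) _ hrI'
            (slicePoint_le_or_le _ _ rfl _ _ _ _)
          rw [slicePoint_sum]
          exact ⟨hst, le_rfl⟩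
      rw [hC, slicePoint_sum] at hrC
      omega
  · rintro rfl
    refine ⟨fun p hp => ?_, fun p hp q hq hpq => ?_⟩
    · have := hmem _ (slice_bounds p).1 (slice_bounds p).2 ((hC p).1 hp).1 ((hC p).1 hp).2
      rwa [slicePoint_self] at this
    · by_contra hqC
      have h1 := sum_le_of_comparable hpq
      have hp' := (hC p).1 hp
      rw [hC] at hqC
      have hq' := slice_bounds q
      -- Comparable points of the fence are equal or adjacent, so `C` can only be left through the
      -- sums `s - 1` and `t + 1`.
      have hq'' : q.1.fst + q.1.snd = s - 1 ∨ q.1.fst + q.1.snd = t + 1 := by omega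
      rw [Set.mem_preimage, ← slicePoint_self q] at hq
      rcases hq'' with h | h
      · simp only [h] at hq hq'
        exact hleft _ _ hq
      · simp only [h] at hq hq'
        exact hright _ _ hq

end SlicePoints

/-! ### Verification of the criterion for each type of interval. -/

section ComponentRows

variable {n m : ℕ} [hn : Fact (1 < n)] [hm : Fact (1 < m)]

/-- The covering map is already onto on the slice, so a preimage containing the whole slice forces
`I'` to be everything. The sums `s - 1` and `t + 1` fall outside the slice. -/
lemma isComponent_fullInterval_iff (I' : PosetInterval (Bipath n m)) :
    (sliceOO n m (-(m : ℤ) + 1) ((n : ℤ) + m) fullRow_nonempty).IsComponent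
      (sliceCoveringMap n m ⁻¹' I'.carrier) ↔ I' = fullInterval n m := by
  have h1 := hn.out
  have h2 := hm.out
  refine isComponent_preimage_iff (I := fullInterval n m) (-2 * (m : ℤ) + 3) (2 * n + 2 * m - 1) le_rfl (by omega) le_rfl
    (fun p => ?_) (fun _ _ _ _ _ => Set.mem_univ _) (fun _ _ => by omega) (fun _ _ => by omega)
    (fun z _ => ?_) (fun _ _ _ hw' => absurd (Set.mem_univ _) hw') I'
  · rw [mem_sliceOO]
    omega
  · have hz := z.isLt
    by_cases h0 : z.val = 0
    · refine ⟨1, by omega, by omega, by omega, by omega, Bipath.ext ?_⟩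
      have := sliceCoveringMap_slicePoint (n := n) (m := m) 1 (by omega) (by omega)
      omega
    · refine ⟨2 * z.val, by omega, by omega, by omega, by omega, Bipath.ext ?_⟩
      have := sliceCoveringMap_slicePoint (n := n) (m := m) (2 * z.val) (by omega) (by omega)
      omega

/-- The component runs from the sum `1`, over `0`, to `2 i + 1`, the last sum over `i` on the top
arm. Its neighbours lie over `n + m - 1` and `i + 1`, the first points of the two chains outside the
interval. -/
lemma isComponent_leftInterval_zero_iff (i : Bipath n m) (hi : i.val < n)
    (I' : PosetInterval (Bipath n m)) :
    (sliceOO n m 0 ((i.val : ℤ) + 1) (leftZeroRow_nonempty i)).IsComponent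
      (sliceCoveringMap n m ⁻¹' I'.carrier) ↔
      I' = leftInterval i (Bipath.zero n m) hi (Or.inl rfl) := by
  have h1 := hn.out
  have h2 := hm.out
  have hI : ∀ z, z ∈ (leftInterval i (Bipath.zero n m) hi (Or.inl rfl)).carrier ↔
      z.val ≤ i.val := by
    intro z
    rw [mem_leftInterval, Bipath.le_def, Bipath.le_def, zero_val]
    omega
  refine isComponent_preimage_iff 1 (2 * i.val + 1) (by omega) (by omega) (by omega)
    (fun p => ?_) (fun r h h' hr hr' => ?_) (fun h h' => ?_) (fun h h' => ?_) (fun z hz => ?_)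
    (fun w hw w' hw' _ => ?_) I'
  · rw [mem_sliceOO]
    omega
  · rw [hI]
    have := sliceCoveringMap_slicePoint r h h'
    omega
  · rw [hI]
    have := sliceCoveringMap_slicePoint _ h h'
    omega
  · rw [hI]
    have := sliceCoveringMap_slicePoint _ h h'
    omega
  · rw [hI] at hz
    refine ⟨2 * z.val + 1, by omega, by omega, by omega, by omega, Bipath.ext ?_⟩
    have := sliceCoveringMap_slicePoint (n := n) (m := m) (2 * z.val + 1) (by omega) (by omega)
    omega
  · rw [hI] at hw'
    have := w'.isLt
    refine ⟨Bipath.zero n m, (hI _).2 (by rw [zero_val]; omega), ?_⟩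
    by_cases hn' : w'.val ≤ n
    · refine ⟨2 * i.val + 1 + 1, by omega, by omega, Or.inr rfl, Or.inl ⟨Bipath.zero_le _, ?_⟩⟩
      have := sliceCoveringMap_slicePoint (n := n) (m := m) (2 * i.val + 1 + 1) (by omega)
        (by omega)
      rw [Bipath.le_def]
      omega
    · refine ⟨1 - 1, by omega, by omega, Or.inl rfl, Or.inl ⟨Bipath.zero_le _, ?_⟩⟩
      have := sliceCoveringMap_slicePoint (n := n) (m := m) (1 - 1) (by omega) (by omega)
      rw [Bipath.le_def]
      omega

/-- The component is the one around the sum `1`. The preimage has a second component at the right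
end of the slice, over `j, …, n + m - 1, 0`, but it does not depend on `i` and cannot detect the
interval. -/
lemma isComponent_leftInterval_iff (i j : Bipath n m) (hi : i.val < n) (hj : n < j.val)
    (I' : PosetInterval (Bipath n m)) :
    (sliceOO n m (-(n : ℤ) - m + j.val) ((i.val : ℤ) + 1) (leftRow_nonempty i j)).IsComponent
      (sliceCoveringMap n m ⁻¹' I'.carrier) ↔ I' = leftInterval i j hi (Or.inr hj) := by
  have h1 := hn.out
  have h2 := hm.out
  have hj' := j.isLt
  have hI : ∀ z, z ∈ (leftInterval i j hi (Or.inr hj)).carrier ↔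
      z.val ≤ i.val ∨ j.val ≤ z.val := by
    intro z
    rw [mem_leftInterval, Bipath.le_def, Bipath.le_def]
    omega
  refine isComponent_preimage_iff (2 * (-(n : ℤ) - m + j.val) + 1) (2 * i.val + 1) (by omega)
    (by omega) (by omega)
    (fun p => ?_) (fun r h h' hr hr' => ?_) (fun h h' => ?_) (fun h h' => ?_) (fun z hz => ?_)
    (fun w hw w' hw' _ => ?_) I'
  · rw [mem_sliceOO]
    omega
  · rw [hI]
    have := sliceCoveringMap_slicePoint r h h'
    omega
  · rw [hI]
    have := sliceCoveringMap_slicePoint _ h h'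
    omega
  · rw [hI]
    have := sliceCoveringMap_slicePoint _ h h'
    omega
  · rw [hI] at hz
    have := z.isLt
    rcases hz with hz | hz
    · refine ⟨2 * z.val + 1, by omega, by omega, by omega, by omega, Bipath.ext ?_⟩
      have := sliceCoveringMap_slicePoint (n := n) (m := m) (2 * z.val + 1) (by omega) (by omega)
      omega
    · refine ⟨2 * (-(n : ℤ) - m + z.val) + 1, by omega, by omega, by omega, by omega,
        Bipath.ext ?_⟩
      have := sliceCoveringMap_slicePoint (n := n) (m := m) (2 * (-(n : ℤ) - m + z.val) + 1)
        (by omega) (by omega)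
      omega
  · rw [hI] at hw'
    have := w'.isLt
    refine ⟨Bipath.zero n m, (hI _).2 (by rw [zero_val]; omega), ?_⟩
    by_cases hn' : w'.val ≤ n
    · refine ⟨2 * i.val + 1 + 1, by omega, by omega, Or.inr rfl, Or.inl ⟨Bipath.zero_le _, ?_⟩⟩
      have := sliceCoveringMap_slicePoint (n := n) (m := m) (2 * i.val + 1 + 1) (by omega)
        (by omega)
      rw [Bipath.le_def]
      omega
    -- This neighbour lies over `j - 1`. For `j = n + 1` it is outside the slice, but then no `w'`
    -- falls under this case: `w' = n` is reached through `i + 1` on the top chain.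
    · refine ⟨2 * (-(n : ℤ) - m + j.val) + 1 - 1, by omega, by omega, Or.inl rfl,
        Or.inl ⟨Bipath.zero_le _, ?_⟩⟩
      have := sliceCoveringMap_slicePoint (n := n) (m := m) (2 * (-(n : ℤ) - m + j.val) + 1 - 1)
        (by omega) (by omega)
      rw [Bipath.le_def]
      omega

/-- The component is the one around the sum `2 n`, which lies over `n`. Its right neighbour lies
over `j + 1`, or over `0` when `j = n + m - 1`; in the latter case it is the last point of the
slice. -/
lemma isComponent_rightInterval_iff (i j : Bipath n m) (hi : 0 < i.val ∧ i.val ≤ n)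
    (hj : n ≤ j.val) (I' : PosetInterval (Bipath n m)) :
    (sliceCC n m i.val j.val (rightRow_nonempty i j hi hj)).IsComponent
      (sliceCoveringMap n m ⁻¹' I'.carrier) ↔ I' = rightInterval i j hi hj := by
  have h1 := hn.out
  have h2 := hm.out
  have hj' := j.isLt
  have hI : ∀ z, z ∈ (rightInterval i j hi hj).carrier ↔ i.val ≤ z.val ∧ z.val ≤ j.val := by
    intro z
    rw [mem_rightInterval, Bipath.le_def, Bipath.le_def]
    omega
  refine isComponent_preimage_iff (2 * i.val) (2 * j.val) (by omega) (by omega) (by omega)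
    (fun p => mem_sliceCC _ p) (fun r h h' hr hr' => ?_) (fun h h' => ?_) (fun h h' => ?_)
    (fun z hz => ?_) (fun w hw w' hw' _ => ?_) I'
  · rw [hI]
    have := sliceCoveringMap_slicePoint r h h'
    omega
  · rw [hI]
    have := sliceCoveringMap_slicePoint _ h h'
    omega
  · rw [hI]
    have := sliceCoveringMap_slicePoint _ h h'
    omega
  · rw [hI] at hz
    refine ⟨2 * z.val, by omega, by omega, by omega, by omega, Bipath.ext ?_⟩
    have := sliceCoveringMap_slicePoint (n := n) (m := m) (2 * z.val) (by omega) (by omega)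
    omega
  · rw [hI] at hw'
    have := w'.isLt
    refine ⟨Bipath.last n m, (hI _).2 (by rw [last_val]; omega), ?_⟩
    by_cases hn' : w'.val ≤ n
    · refine ⟨2 * i.val - 1, by omega, by omega, Or.inl rfl, Or.inr ⟨?_, Bipath.le_last _⟩⟩
      have := sliceCoveringMap_slicePoint (n := n) (m := m) (2 * i.val - 1) (by omega) (by omega)
      rw [Bipath.le_def]
      omega
    · refine ⟨2 * j.val + 1, by omega, by omega, Or.inr rfl, Or.inr ⟨?_, Bipath.le_last _⟩⟩
      have := sliceCoveringMap_slicePoint (n := n) (m := m) (2 * j.val + 1) (by omega) (by omega)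
      rw [Bipath.le_def]
      omega

/-- On the top arm the points over `z` have sums `2 z` and `2 z + 1`, so the neighbours of the
component lie over `i - 1` and `j + 1`. -/
lemma isComponent_topInterval_iff (i j : Bipath n m) (hi : 0 < i.val) (hij : i.val ≤ j.val)
    (hj : j.val < n) (I' : PosetInterval (Bipath n m)) :
    (sliceCO n m i.val ((j.val : ℤ) + 1) (topRow_nonempty i j hij)).IsComponent
      (sliceCoveringMap n m ⁻¹' I'.carrier) ↔ I' = topInterval i j hi hij hj := by
  have h1 := hn.out
  have h2 := hm.out
  have hI : ∀ z, z ∈ (topInterval i j hi hij hj).carrier ↔ i.val ≤ z.val ∧ z.val ≤ j.val := by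
    intro z
    rw [mem_topInterval, Bipath.le_def, Bipath.le_def]
    omega
  refine isComponent_preimage_iff (2 * i.val) (2 * j.val + 1) (by omega) (by omega) (by omega)
    (fun p => ?_) (fun r h h' hr hr' => ?_) (fun h h' => ?_) (fun h h' => ?_)
    (fun z hz => ?_) (fun w hw w' hw' hww' => ?_) I'
  · rw [mem_sliceCO]
    omega
  · rw [hI]
    have := sliceCoveringMap_slicePoint r h h'
    omega
  · rw [hI]
    have := sliceCoveringMap_slicePoint _ h h'
    omega
  · rw [hI]
    have := sliceCoveringMap_slicePoint _ h h'
    omega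
  · rw [hI] at hz
    refine ⟨2 * z.val, by omega, by omega, by omega, by omega, Bipath.ext ?_⟩
    have := sliceCoveringMap_slicePoint (n := n) (m := m) (2 * z.val) (by omega) (by omega)
    omega
  · refine ⟨w, hw, ?_⟩
    rw [hI] at hw hw'
    rw [Bipath.le_def, Bipath.le_def] at hww'
    by_cases hlt : w'.val < i.val
    · refine ⟨2 * i.val - 1, by omega, by omega, Or.inl rfl, Or.inr ?_⟩
      have := sliceCoveringMap_slicePoint (n := n) (m := m) (2 * i.val - 1) (by omega) (by omega)
      rw [Bipath.le_def, Bipath.le_def]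
      omega
    · refine ⟨2 * j.val + 1 + 1, by omega, by omega, Or.inr rfl, Or.inl ?_⟩
      have := sliceCoveringMap_slicePoint (n := n) (m := m) (2 * j.val + 1 + 1) (by omega)
        (by omega)
      rw [Bipath.le_def, Bipath.le_def]
      omega

/-- The bottom chain occurs twice in the slice, and the component is taken in the right copy. In the
left copy the component for `i = n + 1` is cut off by the end of the slice and also occurs for right
intervals with the same `j`. -/
lemma isComponent_bottomInterval_iff (i j : Bipath n m) (hi : n < i.val) (hij : i.val ≤ j.val)
    (I' : PosetInterval (Bipath n m)) :
    (sliceOC n m ((i.val : ℤ) - 1) j.val (bottomRow_nonempty i j hij)).IsComponent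
      (sliceCoveringMap n m ⁻¹' I'.carrier) ↔ I' = bottomInterval i j hi hij := by
  have h1 := hn.out
  have h2 := hm.out
  have hj' := j.isLt
  have hI : ∀ z, z ∈ (bottomInterval i j hi hij).carrier ↔ i.val ≤ z.val ∧ z.val ≤ j.val := by
    intro z
    rw [mem_bottomInterval, Bipath.le_def, Bipath.le_def]
    omega
  refine isComponent_preimage_iff (2 * i.val - 1) (2 * j.val) (by omega) (by omega) (by omega)
    (fun p => ?_) (fun r h h' hr hr' => ?_) (fun h h' => ?_) (fun h h' => ?_)
    (fun z hz => ?_) (fun w hw w' hw' hww' => ?_) I'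
  · rw [mem_sliceOC]
    omega
  · rw [hI]
    have := sliceCoveringMap_slicePoint r h h'
    omega
  · rw [hI]
    have := sliceCoveringMap_slicePoint _ h h'
    omega
  · rw [hI]
    have := sliceCoveringMap_slicePoint _ h h'
    omega
  · rw [hI] at hz
    refine ⟨2 * z.val, by omega, by omega, by omega, by omega, Bipath.ext ?_⟩
    have := sliceCoveringMap_slicePoint (n := n) (m := m) (2 * z.val) (by omega) (by omega)
    omega
  · refine ⟨w, hw, ?_⟩
    have := w'.isLt
    rw [hI] at hw hw'
    rw [Bipath.le_def, Bipath.le_def] at hww'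
    -- The order of the bottom chain reverses the numbers: upwards the interval is left through `i -
    -- 1`, downwards through `j + 1`, or through `0` when `j = n + m - 1`.
    by_cases hlt : w ≤ w'
    · refine ⟨2 * i.val - 1 - 1, by omega, by omega, Or.inl rfl, Or.inl ?_⟩
      have := sliceCoveringMap_slicePoint (n := n) (m := m) (2 * i.val - 1 - 1) (by omega)
        (by omega)
      rw [Bipath.le_def] at hlt
      rw [Bipath.le_def, Bipath.le_def]
      omega
    · refine ⟨2 * j.val + 1, by omega, by omega, Or.inr rfl, Or.inr ?_⟩
      have := sliceCoveringMap_slicePoint (n := n) (m := m) (2 * j.val + 1) (by omega) (by omega)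
      rw [Bipath.le_def] at hlt
      rw [Bipath.le_def, Bipath.le_def]
      omega

end ComponentRows

end

theorem mainTheorem2 {k : Type u} [Field k] (n m : ℕ) [Fact (1 < n)] [Fact (1 < m)]
    (M : PersistenceModule k (Bipath n m)) :
    -- the number of points of the slice
    Nat.card (Slice n m) = 2 * n + 4 * m - 3 ∧
    -- the intervals of the bipath poset are exactly those considered below
    (∀ I : PosetInterval (Bipath n m),
      I = fullInterval n m ∨
      (∃ i j hi hj, I = leftInterval i j hi hj) ∨
      (∃ i j hi hj, I = rightInterval i j hi hj) ∨
      (∃ i j hi hij hj, I = topInterval i j hi hij hj) ∨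
      (∃ i j hi hij, I = bottomInterval i j hi hij)) ∧
    -- the arc code of `M` and the barcode of the finite zigzag module exist and are unique
    (∃! μ, IsBarcode M μ) ∧
    (∃! ν, IsBarcode ((sliceRestriction k n m).obj M) ν) ∧
    -- equality of multiplicities
    ∀ μ ν, IsBarcode M μ → IsBarcode ((sliceRestriction k n m).obj M) ν →
      μ (fullInterval n m) = ν (sliceOO n m (-(m : ℤ) + 1) ((n : ℤ) + m) fullRow_nonempty) ∧
      (∀ (i : Bipath n m) (hi : i.val < n),
        μ (leftInterval i (Bipath.zero n m) hi (Or.inl rfl)) =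
          ν (sliceOO n m 0 ((i.val : ℤ) + 1) (leftZeroRow_nonempty i))) ∧
      (∀ (i j : Bipath n m) (hi : i.val < n) (hj : n < j.val),
        μ (leftInterval i j hi (Or.inr hj)) =
          ν (sliceOO n m (-(n : ℤ) - m + j.val) ((i.val : ℤ) + 1) (leftRow_nonempty i j))) ∧
      (∀ (i j : Bipath n m) (hi : 0 < i.val ∧ i.val ≤ n) (hj : n ≤ j.val),
        μ (rightInterval i j hi hj) =
          ν (sliceCC n m i.val j.val (rightRow_nonempty i j hi hj))) ∧
      (∀ (i j : Bipath n m) (hi : 0 < i.val) (hij : i.val ≤ j.val) (hj : j.val < n),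
        μ (topInterval i j hi hij hj) =
          ν (sliceCO n m i.val ((j.val : ℤ) + 1) (topRow_nonempty i j hij))) ∧
      (∀ (i j : Bipath n m) (hi : n < i.val) (hij : i.val ≤ j.val),
        μ (bottomInterval i j hi hij) =
          ν (sliceOC n m ((i.val : ℤ) - 1) j.val (bottomRow_nonempty i j hij))) := by
  classical
  obtain ⟨ι, _, J, -, ⟨b⟩⟩ := exists_bipath_intervalBasis M
  have := Fintype.ofFinite
    (Σ x : ι, {C : PosetInterval (Slice n m) //
      C.IsComponent (sliceCoveringMap n m ⁻¹' (J x).carrier)})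
  refine ⟨slice_card n m, isBipathInterval, b.existsUnique_isBarcode,
    -- The module `(sliceRestriction k n m).obj M` is by definition the restriction along
    -- `sliceCoveringMap n m`, so the basis `b` also gives its barcode.
    (b.restrictAlong (sliceCoveringMap n m)).existsUnique_isBarcode, fun μ ν hμ hν => ?_⟩
  have key : ∀ {I C}, (∀ I' : PosetInterval (Bipath n m),
      C.IsComponent (sliceCoveringMap n m ⁻¹' I'.carrier) ↔ I' = I) → μ I = ν C :=
    b.barcode_restrictAlong (sliceCoveringMap n m) hμ hν
  exact ⟨key isComponent_fullInterval_iff,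
    fun i hi => key (isComponent_leftInterval_zero_iff i hi),
    fun i j hi hj => key (isComponent_leftInterval_iff i j hi hj),
    fun i j hi hj => key (isComponent_rightInterval_iff i j hi hj),
    fun i j hi hij hj => key (isComponent_topInterval_iff i j hi hij hj),
    fun i j hi hij => key (isComponent_bottomInterval_iff i j hi hij)⟩
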